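/- Let $K$ be a field, let $s\ge 1$ and $n\ge 2$ be integers, let $\Delta$ be the cyclic quiver with $s$ vertices $1,\dots,s$ (taken modulo $s$) and one arrow $x_i\colon i\to i+1$ for each $i$, and let $A=K\Delta/R_\Delta^n$, where $R_\Delta^n$ is the two-sided ideal of the path algebra $K\Delta$ generated by the paths of length $n$. Paths are composed from left to right, and $e_i\in A$ is the idempotent of the vertex $i$. Let $D(A)=\operatorname{Hom}_K(A,K)$ be the dual $A$-bimodule, $(af)(b)=f(ba)$, $(fa)(b)=f(ab)$. For a Hochschild $2$-cocycle $\alpha\colon A\times A\to D(A)$ let $T_\alpha(A)=A\oplus D(A)$ be the Hochschild extension algebra, with product $(a,x)(b,y)=(ab,\;ay+xb+\alpha(a,b))$; thus $T_0(A)$ is the trivial extension algebra $A\ltimes D(A)$. The idempotents $e_i$ of $A$ lift to a complete set of orthogonal idempotents $\mathbf e_1,\dots,\mathbf e_s$ of $T_\alpha(A)$; any such lift consists of primitive idempotents with pairwise non-isomorphic projective modules, and the ordinary quiver $\Delta_{T_\alpha(A)}$ has vertex set $\{1,\dots,s\}$ and $\dim_K \mathbf e_iJ\mathbf e_j/\mathbf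 e_iJ^2\mathbf e_j$ arrows from $i$ to $j$, where $J$ is the Jacobson radical of $T_\alpha(A)$. Equality of two such quivers means that for all $i,j$ they have equally many arrows from $i$ to $j$. For integers $m, q\ge 0$ let $C_{m,q}$ be the $K$-vector space with basis the symbols $p\otimes w$, where $p$ is a path of length $q-m$ with $0\le q-m<n$, $w$ is a path of length $m$, and $pw$ is a cycle. A symbol $p\otimes w$ is read as $0$ if $p$ has length at least $n$. Let $$d_3\colon C_{n+1,q}\to C_{n,q},\quad p\otimes y_1\cdots y_{n+1}\mapsto py_1\otimes y_2\cdots y_{n+1}-y_{n+1}p\otimes y_1\cdots y_n,$$ $$d_2\colon C_{n,q}\to C_{1,q},\quad p\otimes y_1\cdots y_n\mapsto\sum_{j=0}^{n-1}y_{j+2}\cdots y_n\,p\,y_1\cdots y_j\otimes y_{j+1},$$ and let $HH_{2,q}(A)=\operatorname{Ker}d_2/\operatorname{Im}d_3$ be the degree $q$ part of the second Hochschild homology of $A$ (Sköldberg). For $f\in D(C_{n,q})=\operatorname{Hom}_K(C_{n,q},K)$ let $\Theta(f)\colon A\times A\to D(A)$ be the bilinear map such that, for paths $a,b$ of length less than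 $n$, $\Theta(f)(a,b)(x)=f(a_{n+1}\cdots a_r\,x\otimes a_1\cdots a_n)$ if $ab=a_1\cdots a_r$ is a path of length $r\ge n$ (where $p\otimes w$ is read as $0$ unless it lies in $C_{n,q}$), and $\Theta(f)(a,b)=0$ otherwise. For $\varphi\in D(HH_{2,q}(A))$ let $\Theta(\varphi)\in H^2(A,D(A))$ be the class of the $2$-cocycle $\Theta(f)$, where $f\in D(C_{n,q})$ is an extension of the functional on $\operatorname{Ker}d_2$ induced by $\varphi$. **Theorem.** Let $n\le q\le 2n-1$, and let $\alpha\colon A\times A\to D(A)$ be a $2$-cocycle whose class $[\alpha]\in H^2(A,D(A))$ belongs to $\Theta(D(HH_{2,q}(A)))$. 1. If $n\le q\le 2n-2$, then $\Delta_{T_\alpha(A)}=\Delta_{T_0(A)}$. 2. If $q=2n-1$ and $[\alpha]\ne 0$, then $\Delta_{T_\alpha(A)}=\Delta$. -/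

import Mathlib

set_option maxSynthPendingDepth 4

universe u v v' w

noncomputable section

namespace HochExt

/-! ### Hochschild cocycles with values in the dual, and Hochschild extensions -/

section Hochschild

variable (K : Type w) [Field K] (A : Type u) [Ring A] [Algebra K A]

/-- `D(A) = Hom_K(A, K)`. -/
abbrev DD : Type (max u w) := Module.Dual K A

variable {K A} in
/-- The left action of `A` on `D(A)`: `(a f)(b) = f (b a)`. -/
def lact (a : A) (f : DD K A) : DD K A := f ∘ₗ LinearMap.mulRight K a

variable {K A} in
/-- The right action of `A` on `D(A)`: `(f a)(b) = f (a b)`. -/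
def ract (f : DD K A) (a : A) : DD K A := f ∘ₗ LinearMap.mulLeft K a

/-- The Hochschild 2-cochains `Hom_K(A ⊗ A, D(A))`, as bilinear maps. -/
abbrev Cochain2 : Type (max u w) := A →ₗ[K] A →ₗ[K] DD K A

/-- The space `Z²(A, D(A))` of Hochschild 2-cocycles. -/
def cocycles2 : Submodule K (Cochain2 K A) where
  carrier := {α | ∀ a b c : A,
    lact a (α b c) - α (a * b) c + α a (b * c) - ract (α a b) c = 0}
  zero_mem' := fun a b c => by ext x; simp [lact, ract]
  add_mem' := fun {α β} hα hβ a b c => by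
    ext x
    have h1 := LinearMap.congr_fun (hα a b c) x
    have h2 := LinearMap.congr_fun (hβ a b c) x
    simp [lact, ract] at h1 h2 ⊢
    linear_combination h1 + h2
  smul_mem' := fun k α hα a b c => by
    ext x
    have h1 := LinearMap.congr_fun (hα a b c) x
    simp [lact, ract] at h1 ⊢
    linear_combination k * h1

/-- The space `B²(A, D(A))` of Hochschild 2-coboundaries. -/
def coboundaries2 : Submodule K (Cochain2 K A) where
  carrier := {β | ∃ g : A →ₗ[K] DD K A, ∀ a b : A,
    β a b = lact a (g b) - g (a * b) + ract (g a) b}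
  zero_mem' := ⟨0, fun a b => by ext x; simp [lact, ract]⟩
  add_mem' := by
    rintro α β ⟨g, hg⟩ ⟨h, hh⟩
    refine ⟨g + h, fun a b => ?_⟩
    ext x
    simp [lact, ract, hg, hh]
    ring
  smul_mem' := by
    rintro k α ⟨g, hg⟩
    refine ⟨k • g, fun a b => ?_⟩
    ext x
    simp [lact, ract, hg]
    ring

/-- The second Hochschild cohomology `H²(A, D(A)) = Z² / B²`. -/
abbrev H2 : Type (max u w) :=
  cocycles2 K A ⧸ (coboundaries2 K A).submoduleOf (cocycles2 K A)

variable {K A}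

/-- The cohomology class `[α]` of a 2-cocycle `α`. -/
def cohClass (α : cocycles2 K A) : H2 K A := Submodule.Quotient.mk α

/-- The underlying space `A ⊕ D(A)` of the Hochschild extension algebra `T_α(A)`. -/
def HochschildExt (_α : cocycles2 K A) : Type (max u w) := A × DD K A

namespace HochschildExt

variable {α : cocycles2 K A}

instance : AddCommGroup (HochschildExt α) := inferInstanceAs (AddCommGroup (A × DD K A))
instance : Module K (HochschildExt α) := inferInstanceAs (Module K (A × DD K A))

/-- The element `(a, x)` of `T_α(A)`. -/
def mk (a : A) (x : DD K A) : HochschildExt α := (a, x)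

/-- The projection `T_α(A) → A`. -/
def fst (t : HochschildExt α) : A := Prod.fst t

/-- The second component of an element of `T_α(A)`. -/
def snd (t : HochschildExt α) : DD K A := Prod.snd t

/-- `(a, x) (b, y) = (a b, a y + x b + α(a, b))`. -/
instance : Mul (HochschildExt α) :=
  ⟨fun s t => mk (s.fst * t.fst) (lact s.fst t.snd + ract s.snd t.fst + α.1 s.fst t.fst)⟩

/-- The identity is `(1, -α(1, 1))`. -/
instance : One (HochschildExt α) := ⟨mk 1 (-(α.1 1 1))⟩

@[ext] theorem ext {s t : HochschildExt α} (h1 : s.fst = t.fst) (h2 : s.snd = t.snd) : s = t :=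
  Prod.ext h1 h2

@[simp] theorem fst_add (s t : HochschildExt α) : (s + t).fst = s.fst + t.fst := rfl
@[simp] theorem snd_add (s t : HochschildExt α) : (s + t).snd = s.snd + t.snd := rfl
@[simp] theorem fst_zero : (0 : HochschildExt α).fst = 0 := rfl
@[simp] theorem snd_zero : (0 : HochschildExt α).snd = 0 := rfl
@[simp] theorem fst_smul (k : K) (t : HochschildExt α) : (k • t).fst = k • t.fst := rfl
@[simp] theorem snd_smul (k : K) (t : HochschildExt α) : (k • t).snd = k • t.snd := rfl
@[simp] theorem fst_one : (1 : HochschildExt α).fst = 1 := rfl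
@[simp] theorem snd_one : (1 : HochschildExt α).snd = -(α.1 1 1) := rfl
@[simp] theorem fst_mul (s t : HochschildExt α) : (s * t).fst = s.fst * t.fst := rfl
@[simp] theorem snd_mul (s t : HochschildExt α) :
    (s * t).snd = lact s.fst t.snd + ract s.snd t.fst + α.1 s.fst t.fst := rfl

instance : Ring (HochschildExt α) :=
  { (inferInstance : AddCommGroup (HochschildExt α)),
    (inferInstance : Mul (HochschildExt α)),
    (inferInstance : One (HochschildExt α)) with
    left_distrib := fun r s t => by
      ext x
      · simp [mul_add]
      · simp [lact, ract, add_mul]; ring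
    right_distrib := fun r s t => by
      ext x
      · simp [add_mul]
      · simp [lact, ract, mul_add]; ring
    zero_mul := fun t => by ext x <;> simp [lact, ract]
    mul_zero := fun t => by ext x <;> simp [lact, ract]
    mul_assoc := fun r s t => by
      ext x
      · simp [mul_assoc]
      · have h := LinearMap.congr_fun (α.2 r.fst s.fst t.fst) x
        simp [lact, ract, mul_assoc] at h ⊢
        linear_combination -h
    one_mul := fun t => by
      ext x
      · simp
      · have h := LinearMap.congr_fun (α.2 1 1 t.fst) x
        simp [lact, ract] at h ⊢
        linear_combination h
    mul_one := fun t => by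
      ext x
      · simp
      · have h := LinearMap.congr_fun (α.2 t.fst 1 1) x
        simp [lact, ract] at h ⊢
        linear_combination -h }

instance : Algebra K (HochschildExt α) :=
  Algebra.ofModule
    (fun k s t => by ext x <;> simp [lact, ract])
    (fun k s t => by ext x <;> simp [lact, ract])

end HochschildExt

end Hochschild

/-! ### The ordinary quiver -/

section OrdinaryQuiver

variable (K : Type w) [Field K] {T : Type u} [Ring T] [Algebra K T] {V : Type v}

/-- An idempotent is primitive if it is nonzero and not the sum of two nonzero orthogonal
idempotents. -/
structure IsPrimitiveIdem (e : T) : Prop where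
  idem : IsIdempotentElem e
  ne_zero : e ≠ 0
  indecomposable : ∀ g h : T, IsIdempotentElem g → IsIdempotentElem h → g * h = 0 → h * g = 0 →
    e = g + h → g = 0 ∨ h = 0

/-- A complete set of primitive orthogonal idempotents `e i` such that the projective modules
`e i T` are pairwise non-isomorphic (so that `T` is a basic algebra). -/
structure IsBasicSystem [Fintype V] (e : V → T) : Prop where
  complete : CompleteOrthogonalIdempotents e
  primitive : ∀ i, IsPrimitiveIdem (e i)
  basic : ∀ i j, i ≠ j → ¬ ∃ a b : T, a * b = e i ∧ b * a = e j ∧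
    e i * a * e j = a ∧ e j * b * e i = b

variable (T) in
/-- The Jacobson radical of `T`, as a subspace. -/
def rad : Submodule K T := (Ring.jacobson T).restrictScalars K

/-- The subspace `e W f` of `T`. -/
def corner (e f : T) (W : Submodule K T) : Submodule K T :=
  W.map (LinearMap.mulLeft K e ∘ₗ LinearMap.mulRight K f)

/-- The number `dim_K (e i J e j) / (e i J² e j)` of arrows from `i` to `j` in the ordinary
quiver of `T`, where `J` is the Jacobson radical. -/
def arrowNumber (e : V → T) (i j : V) : ℕ :=
  Module.finrank K (corner K (e i) (e j) (rad K T) ⧸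
    (corner K (e i) (e j) (rad K T * rad K T)).submoduleOf (corner K (e i) (e j) (rad K T)))

/-- A quiver with vertex set `V` is given by a family `Q` of types: `Q i j` is the type of
arrows from `i` to `j`. It is the ordinary quiver of `T`, with respect to a complete set
of primitive orthogonal idempotents indexed by `V`, if there are as many arrows from
`i` to `j` as the ordinary quiver has. -/
def IsOrdinaryQuiver [Fintype V] (e : V → T) (Q : V → V → Type v') : Prop :=
  IsBasicSystem e ∧ ∀ i j : V, Finite (Q i j) ∧ Nat.card (Q i j) = arrowNumber K e i j

end OrdinaryQuiver

/-! ### Paths of a quiver -/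

/-- A path of the quiver `V`, together with its source and its target. -/
@[ext] structure QPath (V : Type u) [Quiver.{v} V] where
  /-- the starting vertex -/
  src : V
  /-- the final vertex -/
  tgt : V
  /-- the path itself -/
  path : Quiver.Path src tgt

namespace QPath

variable {V : Type u} [Quiver.{v} V]

/-- The length of a path. -/
def length (p : QPath V) : ℕ := p.path.length

/-- The trivial path at the vertex `i`. -/
def triv (i : V) : QPath V := ⟨i, i, Quiver.Path.nil⟩

open Classical in
/-- The concatenation `p q` (first `p`, then `q`), if the target of `p` is the source of `q`. -/
def comp? (p q : QPath V) : Option (QPath V) :=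
  if h : p.tgt = q.src then
    some ⟨p.src, q.tgt, p.path.comp (q.path.cast h.symm rfl)⟩
  else none

/-- Auxiliary function: cut the path `p` into its first `m` arrows and the remaining arrows
(if `p` has at most `m` arrows, then the first part is `p` and the second one is trivial). -/
def splitAux {i : V} : {j : V} → Quiver.Path i j → ℕ →
    (k : V) × (Quiver.Path i k × Quiver.Path k j)
  | _, .nil, _ => ⟨i, .nil, .nil⟩
  | j, .cons p e, m =>
      if m ≤ p.length then
        ⟨(splitAux p m).1, (splitAux p m).2.1, (splitAux p m).2.2.cons e⟩
      else ⟨j, .cons p e, .nil⟩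

/-- The path formed by the first `m` arrows of `p`. -/
def take (p : QPath V) (m : ℕ) : QPath V :=
  ⟨p.src, (splitAux p.path m).1, (splitAux p.path m).2.1⟩

/-- The path formed by the arrows of `p` after the first `m` ones. -/
def drop (p : QPath V) (m : ℕ) : QPath V :=
  ⟨(splitAux p.path m).1, p.tgt, (splitAux p.path m).2.2⟩

theorem comp?_length {p q r : QPath V} (h : p.comp? q = some r) :
    r.length = p.length + q.length := by
  obtain ⟨a, b, p⟩ := p
  obtain ⟨c, d, q⟩ := q
  unfold comp? at h
  split_ifs at h with h1
  dsimp only at h1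
  subst h1
  simp only [Option.some.injEq] at h
  subst h
  simp [length, Quiver.Path.length_comp]

theorem triv_comp? (p : QPath V) (i : V) [Decidable (i = p.src)] :
    (triv i).comp? p = if i = p.src then some p else none := by
  obtain ⟨a, b, p⟩ := p
  unfold comp? triv
  dsimp only
  split_ifs with h
  · subst h
    simp
  · rfl

theorem comp?_triv (p : QPath V) (i : V) [Decidable (i = p.tgt)] :
    p.comp? (triv i) = if i = p.tgt then some p else none := by
  obtain ⟨a, b, p⟩ := p
  unfold comp? triv
  dsimp only
  by_cases h : i = b
  · subst h
    simp
  · rw [dif_neg (fun h' => h h'.symm), if_neg h]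

theorem comp?_assoc (p q r : QPath V) :
    (p.comp? q).bind (fun t => t.comp? r) = (q.comp? r).bind (fun t => p.comp? t) := by
  obtain ⟨a, b, p⟩ := p
  obtain ⟨c, d, q⟩ := q
  obtain ⟨e, f, r⟩ := r
  by_cases h1 : b = c
  · subst h1
    by_cases h2 : d = e
    · subst h2
      simp [comp?]
    · simp [comp?, h2]
  · by_cases h2 : d = e
    · subst h2
      simp [comp?, h1]
    · simp [comp?, h1, h2]

end QPath

/-! ### The path algebra and its truncations -/

section PathAlgebra

variable (K : Type w) [Field K] (V : Type u) [Quiver.{v} V]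

/-- The path algebra `KΔ` of a quiver: the vector space with basis the paths. -/
def PathAlgebra : Type (max u v w) := QPath V →₀ K

namespace PathAlgebra

instance : AddCommGroup (PathAlgebra K V) := inferInstanceAs (AddCommGroup (QPath V →₀ K))
instance : Module K (PathAlgebra K V) := inferInstanceAs (Module K (QPath V →₀ K))

variable {V}

/-- The basis element of the path algebra given by a path. -/
def of (p : QPath V) : PathAlgebra K V := Finsupp.single p (1 : K)

/-- The product of two paths: their concatenation, or zero. -/
def pathMul (p q : QPath V) : PathAlgebra K V :=
  (p.comp? q).elim 0 (of K)

variable (V) in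
/-- The bilinear extension of `pathMul`. -/
def mulLin : PathAlgebra K V →ₗ[K] PathAlgebra K V →ₗ[K] PathAlgebra K V :=
  Finsupp.linearCombination K
    (fun p : QPath V => (Finsupp.linearCombination K (pathMul K p) :
      (QPath V →₀ K) →ₗ[K] PathAlgebra K V))

instance : Mul (PathAlgebra K V) := ⟨fun f g => mulLin K V f g⟩

instance [Fintype V] : One (PathAlgebra K V) := ⟨∑ i : V, of K (QPath.triv i)⟩

theorem mul_def (f g : PathAlgebra K V) : f * g = mulLin K V f g := rfl

theorem one_def [Fintype V] : (1 : PathAlgebra K V) = ∑ i : V, of K (QPath.triv i) := rfl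

theorem of_mul_of (p q : QPath V) : of K p * of K q = pathMul K p q := by
  rw [mul_def]
  unfold mulLin of
  erw [Finsupp.linearCombination_single, one_smul, Finsupp.linearCombination_single, one_smul]

variable {K} in
theorem induction_on {P : PathAlgebra K V → Prop} (f : PathAlgebra K V)
    (h0 : P 0) (hadd : ∀ f g, P f → P g → P (f + g)) (hsmul : ∀ (c : K) f, P f → P (c • f))
    (hof : ∀ p, P (of K p)) : P f := by
  induction f using Finsupp.induction_linear with
  | zero => exact h0
  | add f g hf hg => exact hadd f g hf hg
  | single p c =>
    have h1 := hsmul c _ (hof p)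
    unfold of at h1
    erw [Finsupp.smul_single', mul_one] at h1
    exact h1

theorem pathMul_assoc (p q r : QPath V) :
    mulLin K V (pathMul K p q) (of K r) = mulLin K V (of K p) (pathMul K q r) := by
  have h := QPath.comp?_assoc p q r
  unfold pathMul
  cases h1 : p.comp? q with
  | none =>
    cases h2 : q.comp? r with
    | none => simp
    | some t =>
      rw [h1, h2] at h
      simp only [Option.bind_none, Option.bind_some] at h
      have h3 := of_mul_of K p t
      rw [mul_def] at h3
      simp [h3, pathMul, ← h]
  | some t =>
    have h3 := of_mul_of K t r
    rw [mul_def] at h3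
    cases h2 : q.comp? r with
    | none =>
      rw [h1, h2] at h
      simp only [Option.bind_none, Option.bind_some] at h
      simp [h3, pathMul, h]
    | some t' =>
      rw [h1, h2] at h
      simp only [Option.bind_some] at h
      have h4 := of_mul_of K p t'
      rw [mul_def] at h4
      simp [h3, h4, pathMul, h]

theorem mul_assoc_aux (f g h : PathAlgebra K V) : f * g * h = f * (g * h) := by
  simp only [mul_def]
  induction f using induction_on with
  | h0 => simp
  | hadd f f' h1 h2 => simp [h1, h2]
  | hsmul c f h1 => simp [h1]
  | hof p =>
    induction g using induction_on with
    | h0 => simp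
    | hadd f f' h1 h2 => simp [h1, h2]
    | hsmul c f h1 => simp [h1]
    | hof q =>
      induction h using induction_on with
      | h0 => simp
      | hadd f f' h1 h2 => simp [h1, h2]
      | hsmul c f h1 => simp [h1]
      | hof r =>
        have h1 := of_mul_of K p q
        have h2 := of_mul_of K q r
        rw [mul_def] at h1 h2
        rw [h1, h2, pathMul_assoc]

variable [Fintype V]

theorem one_mul_aux (f : PathAlgebra K V) : 1 * f = f := by
  classical
  rw [mul_def]
  induction f using induction_on with
  | h0 => simp
  | hadd f f' h1 h2 => simp [h1, h2]
  | hsmul c f h1 => simp [h1]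
  | hof p =>
    rw [one_def, map_sum, LinearMap.sum_apply, Finset.sum_eq_single p.src]
    · rw [← mul_def, of_mul_of, pathMul, QPath.triv_comp?, if_pos rfl]; rfl
    · intro i _ hi
      rw [← mul_def, of_mul_of, pathMul, QPath.triv_comp?, if_neg hi]; rfl
    · simp

theorem mul_one_aux (f : PathAlgebra K V) : f * 1 = f := by
  classical
  rw [mul_def]
  induction f using induction_on with
  | h0 => simp
  | hadd f f' h1 h2 => simp [h1, h2]
  | hsmul c f h1 => simp [h1]
  | hof p =>
    rw [one_def, map_sum, Finset.sum_eq_single p.tgt]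
    · rw [← mul_def, of_mul_of, pathMul, QPath.comp?_triv, if_pos rfl]; rfl
    · intro i _ hi
      rw [← mul_def, of_mul_of, pathMul, QPath.comp?_triv, if_neg hi]; rfl
    · simp

instance : Ring (PathAlgebra K V) :=
  { (inferInstance : AddCommGroup (PathAlgebra K V)),
    (inferInstance : Mul (PathAlgebra K V)),
    (inferInstance : One (PathAlgebra K V)) with
    left_distrib := fun f g h => by simp [mul_def]
    right_distrib := fun f g h => by simp [mul_def]
    zero_mul := fun f => by simp [mul_def]
    mul_zero := fun f => by simp [mul_def]
    mul_assoc := mul_assoc_aux K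
    one_mul := one_mul_aux K
    mul_one := mul_one_aux K }

instance : Algebra K (PathAlgebra K V) :=
  Algebra.ofModule (fun c f g => by simp [mul_def]) (fun c f g => by simp [mul_def])

variable (V) in
/-- The two-sided ideal `R_Δ^n` of the path algebra generated by the paths of length `n`. -/
def arrowIdealPow (n : ℕ) : TwoSidedIdeal (PathAlgebra K V) :=
  TwoSidedIdeal.span {f | ∃ p : QPath V, p.length = n ∧ f = of K p}

end PathAlgebra

variable [Fintype V]

/-- The truncated quiver algebra `KΔ / R_Δ^n`. -/
abbrev TruncAlgebra (n : ℕ) : Type (max u v w) :=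
  PathAlgebra K V ⧸ (PathAlgebra.arrowIdealPow K V n).asIdeal

variable {V}

/-- The residue class in `KΔ / R_Δ^n` of a path. -/
def pathClass (n : ℕ) (p : QPath V) : TruncAlgebra K V n :=
  Ideal.Quotient.mk _ (PathAlgebra.of K p)

/-- The idempotent of `KΔ / R_Δ^n` belonging to a vertex. -/
def vertexIdem (n : ℕ) (i : V) : TruncAlgebra K V n := pathClass K n (QPath.triv i)

variable (V)

/-- The paths of length less than `n`; their classes form the standard basis of `KΔ / R_Δ^n`. -/
abbrev ShortPath (n : ℕ) : Type (max u v) := {p : QPath V // p.length < n}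

/-- The coefficients of an element of the path algebra at the paths of length less than `n`. -/
def shortCoeffAux (n : ℕ) : PathAlgebra K V →ₗ[K] (ShortPath V n →₀ K) :=
  Finsupp.lsubtypeDomain {p : QPath V | p.length < n}

variable {V}

theorem shortCoeffAux_of {n : ℕ} (p : QPath V) (hp : n ≤ p.length) :
    shortCoeffAux K V n (PathAlgebra.of K p) = 0 := by
  refine Finsupp.ext fun r => ?_
  have h : p ≠ r.1 := by
    intro h
    have := r.2
    rw [← h] at this
    exact absurd this (not_lt.2 hp)
  exact Finsupp.single_eq_of_ne (Ne.symm h)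

theorem shortCoeffAux_pathMul {n : ℕ} (p q : QPath V) (h : n ≤ p.length ∨ n ≤ q.length) :
    shortCoeffAux K V n (PathAlgebra.pathMul K p q) = 0 := by
  unfold PathAlgebra.pathMul
  cases h1 : p.comp? q with
  | none => exact map_zero _
  | some r =>
    have h2 := QPath.comp?_length h1
    exact shortCoeffAux_of K r (by omega)

theorem eq_zero_of_shortCoeffAux {W : Type*} [AddCommGroup W] [Module K W] {n : ℕ}
    (L : PathAlgebra K V →ₗ[K] W)
    (hL : ∀ p : QPath V, n ≤ p.length → L (PathAlgebra.of K p) = 0)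
    (g : PathAlgebra K V) (hg : shortCoeffAux K V n g = 0) : L g = 0 := by
  have h1 : ∀ g : PathAlgebra K V,
      Finsupp.linearCombination K (fun p => L (PathAlgebra.of K p)) g = L g := by
    intro g
    induction g using PathAlgebra.induction_on with
    | h0 => rw [map_zero]; exact map_zero _
    | hadd f f' h1 h2 => rw [map_add, ← h1, ← h2]; exact map_add _ _ _
    | hsmul c f h1 => rw [map_smul, ← h1]; exact map_smul _ _ _
    | hof p =>
      unfold PathAlgebra.of
      erw [Finsupp.linearCombination_single, one_smul]
  rw [← h1]
  refine (Finsupp.linearCombination_apply K g).trans (Finset.sum_eq_zero fun p _ => ?_)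
  dsimp only
  by_cases hp : n ≤ p.length
  · rw [hL p hp, smul_zero]
  · have h2 : (show QPath V →₀ K from g) p = 0 :=
      DFunLike.congr_fun hg (⟨p, not_le.1 hp⟩ : ShortPath V n)
    exact (congrArg (fun c : K => c • L (PathAlgebra.of K p)) h2).trans (zero_smul K _)

variable (V)

/-- The two-sided ideal of all combinations of paths of length at least `n`. -/
def longIdeal (n : ℕ) : TwoSidedIdeal (PathAlgebra K V) :=
  TwoSidedIdeal.mk' {f | shortCoeffAux K V n f = 0}
    (map_zero _)
    (fun {f g} (hf : _ = _) (hg : _ = _) => by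
      change shortCoeffAux K V n (f + g) = 0
      rw [map_add, hf, hg, add_zero])
    (fun {f} (hf : _ = _) => by
      change shortCoeffAux K V n (-f) = 0
      rw [map_neg, hf, neg_zero])
    (fun {f g} (hg : _ = _) => by
      change shortCoeffAux K V n (PathAlgebra.mulLin K V f g) = 0
      induction f using PathAlgebra.induction_on with
      | h0 => simp
      | hadd f f' h1 h2 => simp [h1, h2]
      | hsmul c f h1 => simp [h1]
      | hof p =>
        refine eq_zero_of_shortCoeffAux K
          (shortCoeffAux K V n ∘ₗ PathAlgebra.mulLin K V (PathAlgebra.of K p)) ?_ g hg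
        intro q hq
        have := PathAlgebra.of_mul_of K p q
        rw [PathAlgebra.mul_def] at this
        rw [LinearMap.comp_apply, this]
        exact shortCoeffAux_pathMul K p q (Or.inr hq))
    (fun {f g} (hf : _ = _) => by
      change shortCoeffAux K V n (PathAlgebra.mulLin K V f g) = 0
      induction g using PathAlgebra.induction_on with
      | h0 => simp
      | hadd f f' h1 h2 => simp [h1, h2]
      | hsmul c f h1 => simp [h1]
      | hof p =>
        refine eq_zero_of_shortCoeffAux K
          (shortCoeffAux K V n ∘ₗ (PathAlgebra.mulLin K V).flip (PathAlgebra.of K p)) ?_ f hf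
        intro q hq
        have := PathAlgebra.of_mul_of K q p
        rw [PathAlgebra.mul_def] at this
        rw [LinearMap.comp_apply, LinearMap.flip_apply, this]
        exact shortCoeffAux_pathMul K q p (Or.inl hq))

theorem shortCoeffAux_eq_zero {n : ℕ} {f : PathAlgebra K V}
    (hf : f ∈ (PathAlgebra.arrowIdealPow K V n).asIdeal) : shortCoeffAux K V n f = 0 := by
  have h : PathAlgebra.arrowIdealPow K V n ≤ longIdeal K V n := by
    refine TwoSidedIdeal.span_le.2 ?_
    rintro _ ⟨p, hp, rfl⟩
    simp only [longIdeal, SetLike.mem_coe]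
    rw [TwoSidedIdeal.mem_mk']
    exact shortCoeffAux_of K p hp.ge
  have h2 := h (TwoSidedIdeal.mem_asIdeal.1 hf)
  rw [longIdeal, TwoSidedIdeal.mem_mk'] at h2
  exact h2

/-- The coefficients of an element of `KΔ / R_Δ^n` at the (classes of the) paths of length
less than `n`. -/
def shortCoeff (n : ℕ) : TruncAlgebra K V n →ₗ[K] (ShortPath V n →₀ K) :=
  (Submodule.liftQ ((PathAlgebra.arrowIdealPow K V n).asIdeal.restrictScalars K)
    (shortCoeffAux K V n) (fun _ hf => shortCoeffAux_eq_zero K V hf)) ∘ₗ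
  (Submodule.Quotient.restrictScalarsEquiv K
    (PathAlgebra.arrowIdealPow K V n).asIdeal).symm.toLinearMap

theorem shortCoeff_mk (n : ℕ) (f : PathAlgebra K V) :
    shortCoeff K V n (Ideal.Quotient.mk _ f) = shortCoeffAux K V n f := rfl

end PathAlgebra

/-! ### The graded second Hochschild homology of a truncated quiver algebra -/

section Homology

variable (K : Type w) [Field K] (V : Type u) [Quiver.{v} V] [Fintype V]

/-- The index set of the basis of the degree `q` part of `A ⊗_{KΔ₀ᵉ} KΔ_m`: the pairs
`p ⊗ y`, where `p` is a path of length less than `n` and `y` is a path of length `m`, such that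
`p y` is a cycle of length `q`. -/
abbrev ChainIndex (n m q : ℕ) : Type (max u v) :=
  {x : ShortPath V n × QPath V // x.2.length = m ∧ x.1.1.length + m = q ∧
    x.1.1.tgt = x.2.src ∧ x.2.tgt = x.1.1.src}

/-- The degree `q` part of `A ⊗_{KΔ₀ᵉ} KΔ_m`, where `A = KΔ / R_Δ^n`. -/
abbrev Chains (n m q : ℕ) : Type (max u v w) := ChainIndex V n m q →₀ K

variable {V}

open Classical in
/-- The degree `q` component of `x ⊗ y` in `A ⊗_{KΔ₀ᵉ} KΔ_m`, for `x` in `A` and a path `y`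
of length `m`. -/
def tens (n m q : ℕ) (y : QPath V) : TruncAlgebra K V n →ₗ[K] Chains K V n m q :=
  Finsupp.linearCombination K (fun p : ShortPath V n =>
    if h : y.length = m ∧ p.1.length + m = q ∧ p.1.tgt = y.src ∧ y.tgt = p.1.src then
      (Finsupp.single ⟨(p, y), h⟩ 1 : Chains K V n m q)
    else 0) ∘ₗ shortCoeff K V n

variable (V)

/-- The degree `q` part of the differential `A ⊗ KΔ_{n+1} → A ⊗ KΔ_n`,
`p ⊗ y₁ ⋯ y_{n+1} ↦ p y₁ ⊗ y₂ ⋯ y_{n+1} - y_{n+1} p ⊗ y₁ ⋯ y_n`. -/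
def d3 (n q : ℕ) : Chains K V n (n + 1) q →ₗ[K] Chains K V n n q :=
  Finsupp.linearCombination K (fun x : ChainIndex V n (n + 1) q =>
    tens K n n q (x.1.2.drop 1) (pathClass K n x.1.1.1 * pathClass K n (x.1.2.take 1)) -
    tens K n n q (x.1.2.take n) (pathClass K n (x.1.2.drop n) * pathClass K n x.1.1.1))

/-- The degree `q` part of the differential `A ⊗ KΔ_n → A ⊗ KΔ_1`,
`p ⊗ y₁ ⋯ y_n ↦ ∑_{0 ≤ j < n} y_{j+2} ⋯ y_n p y₁ ⋯ y_j ⊗ y_{j+1}`. -/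
def d2 (n q : ℕ) : Chains K V n n q →ₗ[K] Chains K V n 1 q :=
  Finsupp.linearCombination K (fun x : ChainIndex V n n q =>
    ∑ j ∈ Finset.range n, tens K n 1 q ((x.1.2.drop j).take 1)
      (pathClass K n (x.1.2.drop (j + 1)) * pathClass K n x.1.1.1 *
        pathClass K n (x.1.2.take j)))

/-- The degree `q` part `HH_{2,q}(A) = Ker d₂ / Im d₃` of the second Hochschild homology of
`A = KΔ / R_Δ^n`. -/
abbrev HH2 (n q : ℕ) : Type (max u v w) :=
  LinearMap.ker (d2 K V n q) ⧸
    (LinearMap.range (d3 K V n q)).submoduleOf (LinearMap.ker (d2 K V n q))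

variable {K V}

/-- The functional `x ↦ f (a_{n+1} ⋯ a_r x ⊗ a₁ ⋯ a_n)` on `A`, if `a b = a₁ ⋯ a_r` is a path of
length `r ≥ n`, and zero otherwise. -/
def thetaPath {n q : ℕ} (f : Module.Dual K (Chains K V n n q)) (a b : QPath V) :
    DD K (TruncAlgebra K V n) :=
  (a.comp? b).elim 0 (fun r =>
    if n ≤ r.length then
      f ∘ₗ tens K n n q (r.take n) ∘ₗ LinearMap.mulLeft K (pathClass K n (r.drop n))
    else 0)

/-- The comparison map `Θ : D((A ⊗_{KΔ₀ᵉ} KΔ_n)_q) → Hom_K(A ⊗ A, D(A))`: the bilinear map which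
is given by `thetaPath f a b` on (the classes of) two paths `a`, `b` of length less than `n`.
It vanishes if `a` or `b` is trivial, since then `a b` is zero or has length less than `n`. -/
def theta {n q : ℕ} (f : Module.Dual K (Chains K V n n q)) : Cochain2 K (TruncAlgebra K V n) :=
  Finsupp.linearCombination K (fun a : ShortPath V n =>
    Finsupp.linearCombination K (fun b : ShortPath V n => thetaPath f a.1 b.1) ∘ₗ
      shortCoeff K V n) ∘ₗ shortCoeff K V n

variable (K V)

/-- The image `Θ(D(HH_{2,q}(A)))` in `H²(A, D(A))`. A functional `φ` on `HH_{2,q}(A)` is a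
functional on the 2-cycles of degree `q` that vanishes on the boundaries; it is extended to a
functional `f` on all 2-chains of degree `q`, and `Θ(φ)` is the class of the 2-cocycle `Θ(f)`. -/
def thetaImage (n q : ℕ) : Set (H2 K (TruncAlgebra K V n)) :=
  {c | ∃ (φ : Module.Dual K (HH2 K V n q)) (f : Module.Dual K (Chains K V n n q))
      (β : cocycles2 K (TruncAlgebra K V n)),
    (∀ z : LinearMap.ker (d2 K V n q), f z.1 = φ (Submodule.Quotient.mk z)) ∧
    β.1 = theta f ∧ c = cohClass β}

variable {K V}

/-- The elements `e i` form a complete set of orthogonal idempotents of `T_α(A)` which lifts the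
vertex idempotents of `A = KΔ / R_Δ^n`. -/
structure IsVertexLift {n : ℕ} {α : cocycles2 K (TruncAlgebra K V n)}
    (e : V → HochschildExt α) : Prop where
  complete : CompleteOrthogonalIdempotents e
  lifts : ∀ i, (e i).fst = vertexIdem K n i

/-- The quiver with vertex set `V` and arrows `Q i j` is the ordinary quiver of the Hochschild
extension algebra `T_α(A)`, where `A = KΔ / R_Δ^n` and `V` is the vertex set of `Δ`:
the vertex idempotents of `A` lift to a complete set of orthogonal idempotents of `T_α(A)`, and
for each such lift `e`, the `e i` are primitive with pairwise non-isomorphic projectives and `Q` is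
the ordinary quiver of `T_α(A)` with respect to `e`. -/
def HasOrdinaryQuiver {n : ℕ} (α : cocycles2 K (TruncAlgebra K V n)) (Q : V → V → Type v') :
    Prop :=
  (∃ e : V → HochschildExt α, IsVertexLift e) ∧
  ∀ e : V → HochschildExt α, IsVertexLift e → IsOrdinaryQuiver K e Q

end Homology

/-! ### The cyclic quiver -/

/-- The vertices of the cyclic quiver with `s` vertices. -/
def Cyc (s : ℕ) : Type := ZMod s

/-- The vertex of the cyclic quiver that follows `i`. -/
def Cyc.next {s : ℕ} (i : Cyc s) : Cyc s := (show ZMod s from i) + 1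

instance (s : ℕ) [NeZero s] : Fintype (Cyc s) := inferInstanceAs (Fintype (ZMod s))

/-- The cyclic quiver: there is one arrow from `i` to `j` if `j` follows `i`, and no arrow from
`i` to `j` otherwise. -/
instance (s : ℕ) : Quiver.{0} (Cyc s) :=
  ⟨fun i j => {_x : Unit // j = i.next}⟩

end HochExt

end

/-!
Write `A = KΔ / R_Δ^n`. In the cyclic quiver a path is determined by its source `i` and its length
`k`; its class `cls i k` runs through the standard basis of `A` for `k < n`, and `filt m`, the span
of the paths of length at least `m`, is the `m`-th power of `rad A`.

The kernel of `T_α(A) → A` squares to zero, so that `J = rad T_α(A)` is the preimage of `rad A`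
(`mem_rad_iff`). Idempotents lift along this projection, and the characters of `T_α(A)` at the
vertices show that every lift of the vertex idempotents is a basic system
(`IsVertexLift.isBasicSystem`). It remains to count arrows, that is, to determine `J²`.

Adding a coboundary to `α` changes the algebra only by an isomorphism over `A`, so that `α` may be
replaced by `Θ(f)`; the substitution is carried out by `untwist`. The elements of `J²` have their
first component in `rad² A`, and `J²` contains every `x ∈ D(A)` that vanishes on the paths of length
`n - 1`, because such an `x` lies in `rad A · D(A)` (`mem_rad_sq_of_fst_eq_zero`). So everything
depends on the values `Θ(f)(a, b)(x)` with `x` a path of length `n - 1`. They involve `f` in degree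
at least `n + (n - 1)`.

If `q ≤ 2n - 2`, then these values are zero (`theta_apply_socle`), and `J²` is given by the same
conditions as for the trivial extension: besides the arrows of `Δ` there is one arrow `i → j` for
each path of length `n - 1` from `j` to `i` (`IsTwist.hasOrdinaryQuiver_extArrow`).

If `q = 2n - 1`, then `d₂ = 0`, and the image of `d₃` is spanned by the differences of consecutive
basis elements `p ⊗ w` of the `2`-chains, so that `f` takes the same value at all of them
(`socleValue_eq`). It is nonzero since `[α] ≠ 0`. A path `a` of length `n - 1` followed by an arrow
`b` has `a b = 0` in `A`, and `Θ(f)(a, b)` is then a nonzero multiple of the functional dual to a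
path of length `n - 1`. All such functionals occur, whence `D(A) ⊆ J²`, and only the arrows of `Δ`
are left (`IsTwist.hasOrdinaryQuiver_hom`).
-/

noncomputable section

namespace HochExt

/-! ### Paths of the cyclic quiver -/

namespace Cyc

variable {s : ℕ}

/-- The vertex of the cyclic quiver reached from `i` after `k` arrows. The recursion matches that
of `Quiver.Path`, so that no casts are needed in `pathFrom`. -/
def shift (i : Cyc s) : ℕ → Cyc s
  | 0 => i
  | k + 1 => (shift i k).next

theorem shift_add (i : Cyc s) (k l : ℕ) : i.shift (k + l) = (i.shift k).shift l := by
  induction l with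
  | zero => rfl
  | succ l ih => exact congrArg next ih

theorem shift_comm (i : Cyc s) (k l : ℕ) : (i.shift k).shift l = (i.shift l).shift k := by
  rw [← shift_add, ← shift_add, add_comm]

theorem shift_eq (i : Cyc s) (k : ℕ) :
    i.shift k = ((show ZMod s from i) + (k : ZMod s) : ZMod s) := by
  induction k with
  | zero => rw [Nat.cast_zero, add_zero]; rfl
  | succ k ih => rw [Nat.cast_succ, ← add_assoc, ← ih]; rfl

theorem exists_shift_eq [NeZero s] (i j : Cyc s) : ∃ k, i.shift k = j := by
  refine ⟨((show ZMod s from j) - (show ZMod s from i)).val, ?_⟩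
  rw [shift_eq, ZMod.natCast_zmod_val]
  exact add_sub_cancel (show ZMod s from i) (show ZMod s from j)

theorem shift_eq_self [NeZero s] {i : Cyc s} {m : ℕ} (h : i.shift m = i) (j : Cyc s) :
    j.shift m = j := by
  obtain ⟨k, rfl⟩ := exists_shift_eq i j
  rw [shift_comm, h]

/-- The path of length `k` that starts at `i`. -/
def pathFrom (i : Cyc s) : (k : ℕ) → Quiver.Path i (i.shift k)
  | 0 => .nil
  | k + 1 => (pathFrom i k).cons ⟨(), rfl⟩

theorem pathFrom_length (i : Cyc s) (k : ℕ) : (pathFrom i k).length = k := by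
  induction k with
  | zero => rfl
  | succ k ih => exact congrArg (· + 1) ih

/-- The path of length `k` that starts at `i`, as an element of `QPath`. -/
def qpath (i : Cyc s) (k : ℕ) : QPath (Cyc s) := ⟨i, i.shift k, pathFrom i k⟩

@[simp] theorem qpath_src (i : Cyc s) (k : ℕ) : (qpath i k).src = i := rfl
@[simp] theorem qpath_length (i : Cyc s) (k : ℕ) : (qpath i k).length = k := pathFrom_length i k

/-- In the cyclic quiver a path is determined by its source and its length. -/
theorem eq_qpath (p : QPath (Cyc s)) : p = qpath p.src p.length := by
  obtain ⟨a, b, p⟩ := p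
  induction p with
  | nil => rfl
  | cons p e ih =>
    obtain ⟨_, rfl⟩ := e
    exact congrArg
      (fun p : QPath (Cyc s) => (⟨p.src, p.tgt.next, p.path.cons ⟨(), rfl⟩⟩ : QPath (Cyc s))) ih

theorem eq_qpath_of {p : QPath (Cyc s)} {i : Cyc s} {k : ℕ} (h1 : p.src = i)
    (h2 : p.length = k) : p = qpath i k := by
  rw [eq_qpath p, h1, h2]

theorem tgt_eq (p : QPath (Cyc s)) : p.tgt = p.src.shift p.length :=
  congrArg QPath.tgt (eq_qpath p)

open Classical in
theorem qpath_comp? (i j : Cyc s) (k l : ℕ) :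
    (qpath i k).comp? (qpath j l) = if j = i.shift k then some (qpath i (k + l)) else none := by
  by_cases h : j = i.shift k
  · obtain ⟨r, hr⟩ : ∃ r, (qpath i k).comp? (qpath j l) = some r := by
      unfold QPath.comp?
      rw [dif_pos (show (qpath i k).tgt = (qpath j l).src from h.symm)]
      exact ⟨_, rfl⟩
    have hl := QPath.comp?_length hr
    rw [qpath_length, qpath_length] at hl
    have hs : r.src = i := by
      unfold QPath.comp? at hr
      rw [dif_pos (show (qpath i k).tgt = (qpath j l).src from h.symm), Option.some.injEq] at hr
      rw [← hr]
      rfl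
    rw [if_pos h, hr, eq_qpath_of hs hl]
  · rw [if_neg h]
    unfold QPath.comp?
    rw [dif_neg fun h' => h h'.symm]

end Cyc

namespace QPath

theorem splitAux_length {V : Type*} [Quiver V] {i j : V} (p : Quiver.Path i j) (m : ℕ) :
    (splitAux p m).2.1.length = min m p.length ∧
      (splitAux p m).2.2.length = p.length - m := by
  induction p with
  | nil => simp [splitAux]
  | cons p e ih =>
    by_cases h : m ≤ p.length
    · have h1 : splitAux (p.cons e) m =
          ⟨(splitAux p m).1, (splitAux p m).2.1, (splitAux p m).2.2.cons e⟩ := if_pos h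
      rw [h1, Quiver.Path.length_cons, Quiver.Path.length_cons, ih.1, ih.2]
      omega
    · have h1 : splitAux (p.cons e) m = ⟨_, p.cons e, .nil⟩ := if_neg h
      rw [h1, Quiver.Path.length_cons, Quiver.Path.length_nil]
      omega

end QPath

namespace Cyc

variable {s : ℕ}

theorem qpath_take (i : Cyc s) {k m : ℕ} (h : m ≤ k) : (qpath i k).take m = qpath i m := by
  refine eq_qpath_of rfl ?_
  refine (QPath.splitAux_length (pathFrom i k) m).1.trans ?_
  rw [pathFrom_length, min_eq_left h]

theorem qpath_drop (i : Cyc s) {k m : ℕ} (h : m ≤ k) :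
    (qpath i k).drop m = qpath (i.shift m) (k - m) := by
  refine eq_qpath_of ?_ ?_
  · exact (show _ = ((qpath i k).take m).tgt from rfl).trans (by rw [qpath_take i h]; rfl)
  · refine (QPath.splitAux_length (pathFrom i k) m).2.trans ?_
    rw [pathFrom_length]

end Cyc

/-! ### The standard basis of a truncated quiver algebra -/

section Trunc

variable {K : Type*} [Field K] {V : Type*} [Quiver V] [Fintype V]

theorem pathClass_mul (n : ℕ) (p q : QPath V) :
    pathClass K n p * pathClass K n q = (p.comp? q).elim 0 (pathClass K n) := by
  unfold pathClass
  rw [← map_mul, PathAlgebra.of_mul_of, PathAlgebra.pathMul]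
  cases p.comp? q with
  | none => exact map_zero _
  | some r => rfl

/-- The linear map on `KΔ / R_Δ^n` with prescribed values at the paths of length less than `n`. -/
def truncLift {n : ℕ} {W : Type*} [AddCommGroup W] [Module K W] (F : ShortPath V n → W) :
    TruncAlgebra K V n →ₗ[K] W :=
  Finsupp.linearCombination K F ∘ₗ shortCoeff K V n

theorem truncLift_pathClass {n : ℕ} {W : Type*} [AddCommGroup W] [Module K W]
    (F : ShortPath V n → W) (p : QPath V) :
    truncLift (K := K) F (pathClass K n p) = if h : p.length < n then F ⟨p, h⟩ else 0 := by
  unfold truncLift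
  rw [LinearMap.comp_apply, pathClass, shortCoeff_mk]
  split_ifs with h
  · have : shortCoeffAux K V n (PathAlgebra.of K p) =
        Finsupp.single (⟨p, h⟩ : ShortPath V n) 1 := by
      classical
      refine Finsupp.ext fun r => ?_
      refine (Finsupp.single_apply (a := p) (a' := r.1) (b := (1 : K))).trans ?_
      rw [Finsupp.single_apply]
      exact if_congr (Subtype.ext_iff (a1 := (⟨p, h⟩ : ShortPath V n))).symm rfl rfl
    rw [this, Finsupp.linearCombination_single, one_smul]
  · rw [shortCoeffAux_of K p (not_lt.1 h), map_zero]

theorem span_pathClass (n : ℕ) : Submodule.span K (Set.range (pathClass K (V := V) n)) = ⊤ := by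
  refine eq_top_iff.2 fun a _ => ?_
  obtain ⟨f, rfl⟩ := Ideal.Quotient.mk_surjective a
  induction f using PathAlgebra.induction_on with
  | h0 => rw [map_zero]; exact zero_mem _
  | hadd f g hf hg => rw [map_add]; exact add_mem (hf trivial) (hg trivial)
  | hsmul c f hf => exact Submodule.smul_mem _ c (hf trivial)
  | hof p => exact Submodule.subset_span ⟨p, rfl⟩

end Trunc

/-! ### The truncated cyclic quiver algebra -/

section CycAlgebra

open Classical

variable (K : Type*) [Field K] {s : ℕ} [NeZero s] (n : ℕ)

/-- The class in `A` of the path of length `k` that starts at `i`. -/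
def cls (i : Cyc s) (k : ℕ) : TruncAlgebra K (Cyc s) n := pathClass K n (Cyc.qpath i k)

variable {K n}

theorem vertexIdem_eq (i : Cyc s) : vertexIdem K n i = cls K n i 0 := rfl

theorem cls_mul (i j : Cyc s) (k l : ℕ) :
    cls K n i k * cls K n j l = if j = i.shift k then cls K n i (k + l) else 0 := by
  unfold cls
  rw [pathClass_mul, Cyc.qpath_comp?]
  split_ifs <;> rfl

theorem cls_eq_zero (i : Cyc s) {k : ℕ} (h : n ≤ k) : cls K n i k = 0 := by
  have h1 : cls K n i n = 0 := by
    refine Ideal.Quotient.eq_zero_iff_mem.2 (TwoSidedIdeal.mem_asIdeal.2 ?_)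
    exact TwoSidedIdeal.subset_span ⟨_, Cyc.qpath_length i n, rfl⟩
  have h2 := cls_mul (K := K) (n := n) i (i.shift n) n (k - n)
  rw [if_pos rfl, h1, zero_mul, Nat.add_sub_cancel' h] at h2
  exact h2.symm

theorem truncLift_cls {W : Type*} [AddCommGroup W] [Module K W] (F : ShortPath (Cyc s) n → W)
    (i : Cyc s) {k : ℕ} (h : k < n) :
    truncLift (K := K) F (cls K n i k) = F ⟨Cyc.qpath i k, by rwa [Cyc.qpath_length]⟩ := by
  rw [cls, truncLift_pathClass, dif_pos (by rwa [Cyc.qpath_length])]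

theorem cyc_linearMap_ext {W : Type*} [AddCommGroup W] [Module K W]
    {f g : TruncAlgebra K (Cyc s) n →ₗ[K] W}
    (h : ∀ i k, k < n → f (cls K n i k) = g (cls K n i k)) : f = g := by
  refine LinearMap.ext_on_range (span_pathClass n) fun p => ?_
  rw [Cyc.eq_qpath p]
  by_cases hp : p.length < n
  · exact h _ _ hp
  · have := cls_eq_zero (K := K) p.src (not_lt.1 hp)
    rw [cls] at this
    rw [this, map_zero, map_zero]

variable (K n) in
/-- The coefficient of an element of `A` at the path of length `k` that starts at `i`; it is zero
if `k ≥ n`. -/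
def coef (i : Cyc s) (k : ℕ) : TruncAlgebra K (Cyc s) n →ₗ[K] K :=
  truncLift fun p => if p.1.src = i ∧ p.1.length = k then 1 else 0

theorem coef_cls (i j : Cyc s) (k : ℕ) {l : ℕ} (hl : l < n) :
    coef K n i k (cls K n j l) = if j = i ∧ l = k then 1 else 0 := by
  rw [coef, truncLift_cls _ _ hl]
  simp

theorem sum_coef_smul (a : TruncAlgebra K (Cyc s) n) :
    a = ∑ i : Cyc s, ∑ k ∈ Finset.range n, coef K n i k a • cls K n i k := by
  have h : LinearMap.id = ∑ i : Cyc s, ∑ k ∈ Finset.range n,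
      (coef K n i k).smulRight (cls K n i k) := by
    refine cyc_linearMap_ext fun j l hl => ?_
    simp only [LinearMap.id_apply, LinearMap.sum_apply, LinearMap.smulRight_apply, coef_cls _ _ _ hl]
    rw [Finset.sum_eq_single j, Finset.sum_eq_single l]
    · simp
    · intro k _ hk
      simp [hk.symm]
    · intro h
      exact absurd (Finset.mem_range.2 hl) h
    · intro i _ hi
      simp [hi.symm]
    · simp
  simpa using LinearMap.congr_fun h a

theorem coef_zero_mul (i : Cyc s) (a b : TruncAlgebra K (Cyc s) n) :
    coef K n i 0 (a * b) = coef K n i 0 a * coef K n i 0 b := by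
  have h : (LinearMap.mul K (TruncAlgebra K (Cyc s) n)).compr₂ (coef K n i 0) =
      (LinearMap.mul K K).compl₁₂ (coef K n i 0) (coef K n i 0) := by
    refine cyc_linearMap_ext fun j k hk => cyc_linearMap_ext fun j' k' hk' => ?_
    rw [LinearMap.compr₂_apply, LinearMap.compl₁₂_apply, LinearMap.mul_apply', LinearMap.mul_apply',
      cls_mul, coef_cls _ _ _ hk, coef_cls _ _ _ hk']
    by_cases h0 : k = 0 ∧ k' = 0
    · obtain ⟨rfl, rfl⟩ := h0
      by_cases h1 : j' = j
      · subst h1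
        rw [if_pos (show j' = j'.shift 0 from rfl), coef_cls _ _ _ hk]
        simp
      · rw [if_neg (show ¬ j' = j.shift 0 from h1), map_zero, eq_comm, mul_eq_zero]
        by_cases h2 : j = i
        · exact Or.inr (if_neg fun h3 => h1 (h3.1.trans h2.symm))
        · exact Or.inl (if_neg fun h3 => h2 h3.1)
    · have h1 : coef K n i 0 (cls K n j (k + k')) = 0 := by
        by_cases h2 : k + k' < n
        · rw [coef_cls _ _ _ h2, if_neg (by omega)]
        · rw [cls_eq_zero _ (not_lt.1 h2), map_zero]
      rw [apply_ite (coef K n i 0), h1, map_zero, ite_self, eq_comm, mul_eq_zero]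
      by_cases h2 : k = 0
      · exact Or.inr (if_neg fun h3 => h0 ⟨h2, h3.2⟩)
      · exact Or.inl (if_neg fun h3 => h2 h3.2)
  exact LinearMap.congr_fun₂ h a b

variable (K n) in
/-- The subspace of `A` spanned by the paths of length at least `m`, that is, the `m`-th power of
the radical of `A`. -/
def filt (m : ℕ) : Submodule K (TruncAlgebra K (Cyc s) n) :=
  Submodule.span K {a | ∃ i k, m ≤ k ∧ a = cls K n i k}

theorem cls_mem_filt (i : Cyc s) {k m : ℕ} (h : m ≤ k) : cls K n i k ∈ filt K n m :=
  Submodule.subset_span ⟨i, k, h, rfl⟩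

theorem mem_filt {m : ℕ} (a : TruncAlgebra K (Cyc s) n) :
    a ∈ filt K n m ↔ ∀ i, ∀ k < m, coef K n i k a = 0 := by
  constructor
  · intro ha i k hk
    refine Submodule.span_le (p := LinearMap.ker (coef K n i k)) |>.2 ?_ ha
    rintro _ ⟨j, l, hl, rfl⟩
    rw [SetLike.mem_coe, LinearMap.mem_ker]
    by_cases hn : l < n
    · rw [coef_cls _ _ _ hn, if_neg (by omega)]
    · rw [cls_eq_zero _ (not_lt.1 hn), map_zero]
  · intro h
    rw [sum_coef_smul a]
    refine Submodule.sum_mem _ fun i _ => Submodule.sum_mem _ fun k _ => ?_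
    by_cases hk : k < m
    · rw [h i k hk, zero_smul]
      exact zero_mem _
    · exact Submodule.smul_mem _ _ (cls_mem_filt i (not_lt.1 hk))

theorem mul_mem_filt {l m : ℕ} {a b : TruncAlgebra K (Cyc s) n} (ha : a ∈ filt K n l)
    (hb : b ∈ filt K n m) : a * b ∈ filt K n (l + m) := by
  have h : filt K n l * filt K n m ≤ filt K (s := s) n (l + m) := by
    rw [filt, filt, Submodule.span_mul_span]
    refine Submodule.span_le.2 ?_
    rintro _ ⟨_, ⟨i, k, hk, rfl⟩, _, ⟨j, k', hk', rfl⟩, rfl⟩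
    simp only [cls_mul]
    split_ifs
    · exact cls_mem_filt _ (by omega)
    · exact zero_mem _
  exact h (Submodule.mul_mem_mul ha hb)

theorem filt_zero : filt K (s := s) n 0 = ⊤ :=
  eq_top_iff.2 fun a _ => (mem_filt a).2 fun _ _ hk => absurd hk (Nat.not_lt_zero _)

theorem eq_zero_of_mem_filt {m : ℕ} (h : n ≤ m) {a : TruncAlgebra K (Cyc s) n}
    (ha : a ∈ filt K n m) : a = 0 := by
  rw [sum_coef_smul a]
  refine Finset.sum_eq_zero fun i _ => Finset.sum_eq_zero fun k hk => ?_
  rw [(mem_filt a).1 ha i k ((Finset.mem_range.1 hk).trans_le h), zero_smul]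

theorem mul_mem_filt_left {m : ℕ} (a : TruncAlgebra K (Cyc s) n) {b : TruncAlgebra K (Cyc s) n}
    (hb : b ∈ filt K n m) : a * b ∈ filt K n m := by
  have := mul_mem_filt (l := 0) (a := a) (by rw [filt_zero]; trivial) hb
  rwa [zero_add] at this

theorem mul_mem_filt_right {m : ℕ} {a : TruncAlgebra K (Cyc s) n} (ha : a ∈ filt K n m)
    (b : TruncAlgebra K (Cyc s) n) : a * b ∈ filt K n m :=
  mul_mem_filt (m := 0) ha (by rw [filt_zero]; trivial)

theorem pow_mem_filt {a : TruncAlgebra K (Cyc s) n} (ha : a ∈ filt K n 1) (m : ℕ) :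
    a ^ m ∈ filt K n m := by
  induction m with
  | zero => rw [filt_zero]; trivial
  | succ m ih => rw [pow_succ]; exact mul_mem_filt ih ha

variable (K n) in
/-- The sum of all arrows. Right multiplication by it prolongs every path by one arrow. -/
def arrowSum : TruncAlgebra K (Cyc s) n := ∑ i : Cyc s, cls K n i 1

theorem arrowSum_mem : arrowSum K n ∈ filt K (s := s) n 1 :=
  Submodule.sum_mem _ fun i _ => cls_mem_filt i le_rfl

theorem cls_mul_arrowSum (i : Cyc s) (k : ℕ) :
    cls K n i k * arrowSum K n = cls K n i (k + 1) := by
  rw [arrowSum, Finset.mul_sum, Finset.sum_eq_single (i.shift k)]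
  · rw [cls_mul, if_pos rfl]
  · intro j _ hj
    rw [cls_mul, if_neg hj]
  · simp

theorem exists_mul_arrowSum {m : ℕ} {a : TruncAlgebra K (Cyc s) n} (ha : a ∈ filt K n (m + 1)) :
    ∃ b ∈ filt K n m, b * arrowSum K n = a := by
  refine Submodule.span_le
    (p := (filt K n m).map (LinearMap.mulRight K (arrowSum K n))) |>.2 ?_ ha
  rintro _ ⟨i, k, hk, rfl⟩
  obtain ⟨k, rfl⟩ : ∃ k', k = k' + 1 := ⟨k - 1, by omega⟩
  exact ⟨cls K n i k, cls_mem_filt i (by omega), cls_mul_arrowSum i k⟩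

/-- A functional on `A` that vanishes at the paths of maximal length `n - 1` lies in
`rad A · D(A)`. -/
theorem exists_lact_arrowSum {x : DD K (TruncAlgebra K (Cyc s) n)}
    (hx : ∀ i, x (cls K n i (n - 1)) = 0) :
    ∃ y : DD K (TruncAlgebra K (Cyc s) n), lact (arrowSum K n) y = x := by
  refine ⟨truncLift fun p => x (cls K n p.1.src (p.1.length - 1)),
    cyc_linearMap_ext fun i k hk => ?_⟩
  rw [lact, LinearMap.comp_apply, LinearMap.mulRight_apply, cls_mul_arrowSum]
  by_cases h : k + 1 < n
  · rw [truncLift_cls _ _ h]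
    simp
  · rw [cls_eq_zero i (not_lt.1 h), map_zero, ← hx i]
    congr 2
    omega

end CycAlgebra

/-! ### Counting the arrows of an ordinary quiver -/

/-- If a linear map `L : J → K^Q` is onto, sees only the corner `e i J e j`, and its kernel in that
corner is `e i J² e j`, then there are `|Q|` arrows from `i` to `j`. -/
theorem arrowNumber_eq_card {K T V Q : Type*} [Field K] [Ring T] [Algebra K T] [Finite Q]
    {e : V → T} {i j : V} (hi : IsIdempotentElem (e i)) (hj : IsIdempotentElem (e j))
    (L : T →ₗ[K] (Q → K))
    (hL : ∀ u, ∃ t ∈ rad K T, L t = u)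
    (h1 : ∀ t ∈ rad K T, L (e i * (t * e j)) = L t)
    (h2 : ∀ t ∈ rad K T, L t = 0 → e i * (t * e j) ∈ rad K T * rad K T)
    (h3 : ∀ t ∈ rad K T * rad K T, L t = 0) :
    arrowNumber K e i j = Nat.card Q := by
  have hsq : rad K T * rad K T ≤ rad K T :=
    Submodule.mul_le.2 fun a _ b hb => Ideal.mul_mem_left (Ring.jacobson T) a hb
  let M : corner K (e i) (e j) (rad K T) →ₗ[K] (Q → K) :=
    L.domRestrict (corner K (e i) (e j) (rad K T))
  have hM : Function.Surjective M := by
    intro u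
    obtain ⟨t, ht, rfl⟩ := hL u
    exact ⟨⟨_, t, ht, rfl⟩, h1 t ht⟩
  have hker : (corner K (e i) (e j) (rad K T * rad K T)).submoduleOf
      (corner K (e i) (e j) (rad K T)) = LinearMap.ker M := by
    ext ⟨_, t, ht, rfl⟩
    rw [Submodule.submoduleOf, Submodule.mem_comap, LinearMap.mem_ker]
    change e i * (t * e j) ∈ _ ↔ L (e i * (t * e j)) = 0
    rw [h1 t ht]
    constructor
    · rintro ⟨w, hw, hwt⟩
      change e i * (w * e j) = _ at hwt
      rw [← h1 t ht, ← hwt, h1 w (hsq hw), h3 w hw]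
    · intro h
      refine ⟨_, h2 t ht h, ?_⟩
      change e i * (e i * (t * e j) * e j) = _
      rw [mul_assoc (e i), mul_assoc t, hj.eq, ← mul_assoc, hi.eq]
  have := Fintype.ofFinite Q
  rw [arrowNumber, ((Submodule.quotEquivOfEq _ _ hker).trans
    (M.quotKerEquivOfSurjective hM)).finrank_eq, Module.finrank_pi, Nat.card_eq_fintype_card]

/-! ### Hochschild extensions of the truncated cyclic quiver algebra -/

section Extension

variable {K : Type*} [Field K] {s : ℕ} [NeZero s] {n : ℕ}

theorem one_eq_sum_cls : (1 : TruncAlgebra K (Cyc s) n) = ∑ i : Cyc s, cls K n i 0 := by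
  refine (congrArg (Ideal.Quotient.mk _) (PathAlgebra.one_def (V := Cyc s) K)).trans ?_
  rw [map_sum]
  rfl

theorem coef_zero_one (hn : 0 < n) (i : Cyc s) : coef K n i 0 1 = 1 := by
  classical
  rw [one_eq_sum_cls, map_sum, Finset.sum_eq_single i]
  · rw [coef_cls _ _ _ hn, if_pos ⟨rfl, rfl⟩]
  · intro j _ hj
    rw [coef_cls _ _ _ hn, if_neg fun h => hj h.1]
  · simp

theorem mem_filt_one {a : TruncAlgebra K (Cyc s) n} :
    a ∈ filt K n 1 ↔ ∀ i, coef K n i 0 a = 0 := by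
  rw [mem_filt]
  refine forall_congr' fun i => ⟨fun h => h 0 zero_lt_one, fun h k hk => ?_⟩
  rwa [Nat.lt_one_iff.1 hk]

theorem vertexIdem_complete :
    CompleteOrthogonalIdempotents (vertexIdem K n : Cyc s → TruncAlgebra K (Cyc s) n) where
  idem i := (cls_mul i i 0 0).trans (if_pos rfl)
  ortho i j hij := (cls_mul i j 0 0).trans (if_neg fun h => hij h.symm)
  complete := one_eq_sum_cls.symm

variable {α : cocycles2 K (TruncAlgebra K (Cyc s) n)}

/-- The projection `T_α(A) → A` as a ring homomorphism. -/
def fstHom (α : cocycles2 K (TruncAlgebra K (Cyc s) n)) :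
    HochschildExt α →+* TruncAlgebra K (Cyc s) n where
  toFun := HochschildExt.fst
  map_zero' := rfl
  map_one' := rfl
  map_add' _ _ := rfl
  map_mul' _ _ := rfl

/-- The projection `T_α(A) → A` as a linear map. -/
def fstLin (α : cocycles2 K (TruncAlgebra K (Cyc s) n)) :
    HochschildExt α →ₗ[K] TruncAlgebra K (Cyc s) n where
  toFun := HochschildExt.fst
  map_add' _ _ := rfl
  map_smul' _ _ := rfl

theorem isNilpotent_of_fst_mem {t : HochschildExt α} (ht : t.fst ∈ filt K n 1) :
    IsNilpotent t := by
  have h1 : (t ^ n).fst = 0 :=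
    (map_pow (fstHom α) t n).trans (eq_zero_of_mem_filt le_rfl (pow_mem_filt ht n))
  refine ⟨n * 2, ?_⟩
  rw [pow_mul, sq]
  refine HochschildExt.ext ?_ (LinearMap.ext fun x => ?_)
  · rw [HochschildExt.fst_mul, h1, zero_mul, HochschildExt.fst_zero]
  · rw [HochschildExt.snd_mul, h1]
    simp [lact, ract]

/-- The radical of `T_α(A)` consists of the `(a, x)` with `a` in the radical of `A`. -/
theorem mem_rad_iff (hn : 0 < n) {t : HochschildExt α} :
    t ∈ rad K (HochschildExt α) ↔ t.fst ∈ filt K n 1 := by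
  rw [rad, Submodule.restrictScalars_mem, ← Ideal.jacobson_bot, Ideal.mem_jacobson_iff]
  constructor
  · intro h
    refine mem_filt_one.2 fun i => ?_
    -- If the coefficient `c` at the vertex `i` were nonzero, `1 - c⁻¹ t` would be a unit that
    -- the character at `i` sends to zero.
    by_contra hc
    obtain ⟨z, hz⟩ := h (-(coef K n i 0 t.fst)⁻¹ • 1)
    have h1 := congrArg (fun u : HochschildExt α => coef K n i 0 u.fst) ((Submodule.mem_bot _).1 hz)
    simp only [sub_eq_add_neg, HochschildExt.fst_add, HochschildExt.fst_mul,
      HochschildExt.fst_zero, map_zero, map_add, coef_zero_mul] at h1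
    rw [show (-1 : HochschildExt α).fst = -1 from rfl,
      show (-(coef K n i 0 t.fst)⁻¹ • (1 : HochschildExt α)).fst =
        -(coef K n i 0 t.fst)⁻¹ • (1 : TruncAlgebra K (Cyc s) n) from rfl,
      map_smul, map_neg, coef_zero_one hn, smul_eq_mul, mul_one, mul_assoc, neg_mul,
      inv_mul_cancel₀ hc] at h1
    refine one_ne_zero (α := K) ?_
    linear_combination -h1
  · intro h y
    have h1 : (-(y * t)).fst ∈ filt K n 1 := by
      rw [show (-(y * t)).fst = -(y.fst * t.fst) from rfl]
      exact neg_mem (mul_mem_filt_left _ h)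
    obtain ⟨z, hz⟩ := (isNilpotent_of_fst_mem h1).isUnit_one_sub.exists_left_inv
    refine ⟨z, (Submodule.mem_bot _).2 ?_⟩
    rw [← hz]
    noncomm_ring

theorem exists_vertexLift (α : cocycles2 K (TruncAlgebra K (Cyc s) n)) :
    ∃ e : Cyc s → HochschildExt α, IsVertexLift e := by
  obtain ⟨e, he, hf⟩ := CompleteOrthogonalIdempotents.lift_of_isNilpotent_ker (fstHom α)
    (fun t ht => isNilpotent_of_fst_mem (by
      rw [show t.fst = 0 from ht]
      exact zero_mem _))
    vertexIdem_complete (fun i => ⟨HochschildExt.mk (vertexIdem K n i) 0, rfl⟩)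
  exact ⟨e, he, fun i => congrFun hf i⟩

theorem eq_zero_of_idem {g : HochschildExt α} (hg : IsIdempotentElem g)
    (h : ∀ i, coef K n i 0 g.fst = 0) : g = 0 := by
  obtain ⟨m, hm⟩ := isNilpotent_of_fst_mem (mem_filt_one.2 h)
  rw [← hg.pow_succ_eq m, pow_succ, hm, zero_mul]

/-- The characters of `T_α(A)` at the vertices detect idempotents, so that any lift of the vertex
idempotents is a basic system of primitive idempotents. -/
theorem IsVertexLift.isBasicSystem (hn : 0 < n) {e : Cyc s → HochschildExt α}
    (he : IsVertexLift e) : IsBasicSystem e := by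
  classical
  have hχ : ∀ i j, coef K n j 0 (e i).fst = if i = j then 1 else 0 := fun i j => by
    rw [he.lifts, vertexIdem_eq, coef_cls _ _ _ hn]
    simp
  refine ⟨he.complete, fun i => ⟨he.complete.idem i, fun h => ?_, ?_⟩, ?_⟩
  · have h1 := hχ i i
    rw [h, HochschildExt.fst_zero, map_zero, if_pos rfl] at h1
    exact zero_ne_one h1
  · intro g h hg hh hgh _ hsum
    have hmul : ∀ j, coef K n j 0 g.fst * coef K n j 0 h.fst = 0 := fun j => by
      rw [← coef_zero_mul, ← HochschildExt.fst_mul, hgh, HochschildExt.fst_zero, map_zero]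
    have hadd : ∀ j, coef K n j 0 g.fst + coef K n j 0 h.fst = if i = j then 1 else 0 := fun j => by
      rw [← map_add, ← HochschildExt.fst_add, ← hsum, hχ]
    have hboth : ∀ j, i ≠ j → coef K n j 0 g.fst = 0 ∧ coef K n j 0 h.fst = 0 := fun j hj => by
      have h1 := hadd j
      rw [if_neg hj] at h1
      have h2 := hmul j
      rw [eq_neg_of_add_eq_zero_right h1, mul_neg, neg_eq_zero, mul_self_eq_zero] at h2
      rw [h2, zero_add] at h1
      exact ⟨h2, h1⟩
    rcases mul_eq_zero.1 (hmul i) with h0 | h0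
    · refine Or.inl (eq_zero_of_idem hg fun j => ?_)
      by_cases hj : i = j
      · rw [← hj, h0]
      · exact (hboth j hj).1
    · refine Or.inr (eq_zero_of_idem hh fun j => ?_)
      by_cases hj : i = j
      · rw [← hj, h0]
      · exact (hboth j hj).2
  · rintro i j hij ⟨a, b, hab, hba, -⟩
    have h1 := hχ i i
    have h2 := hχ j i
    rw [← hab, HochschildExt.fst_mul, coef_zero_mul, if_pos rfl] at h1
    rw [← hba, HochschildExt.fst_mul, coef_zero_mul, if_neg hij.symm, mul_comm, h1] at h2
    exact one_ne_zero h2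

theorem hasOrdinaryQuiver_of (hn : 0 < n) {Q : Cyc s → Cyc s → Type*} [∀ i j, Finite (Q i j)]
    (h : ∀ e : Cyc s → HochschildExt α, IsVertexLift e →
      ∀ i j, arrowNumber K e i j = Nat.card (Q i j)) : HasOrdinaryQuiver α Q :=
  ⟨exists_vertexLift α, fun e he =>
    ⟨he.isBasicSystem hn, fun i j => ⟨inferInstance, (h e he i j).symm⟩⟩⟩

theorem fst_mem_of_mem_rad_sq (hn : 0 < n) {t : HochschildExt α}
    (ht : t ∈ rad K (HochschildExt α) * rad K (HochschildExt α)) : t.fst ∈ filt K n 2 := by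
  have h : rad K (HochschildExt α) * rad K (HochschildExt α) ≤
      (filt K n 2).comap (fstLin α) :=
    Submodule.mul_le.2 fun a ha b hb =>
      mul_mem_filt ((mem_rad_iff hn).1 ha) ((mem_rad_iff hn).1 hb)
  exact h ht

/-- `rad A · D(A)` lies in the square of the radical of `T_α(A)`. -/
theorem mem_rad_sq_of_fst_eq_zero (hn : 0 < n) {t : HochschildExt α} (ht : t.fst = 0)
    (ht' : ∀ i, t.snd (cls K n i (n - 1)) = 0) :
    t ∈ rad K (HochschildExt α) * rad K (HochschildExt α) := by
  obtain ⟨y, hy⟩ := exists_lact_arrowSum ht'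
  have h : t = HochschildExt.mk (arrowSum K n) 0 * HochschildExt.mk 0 y := by
    refine HochschildExt.ext (ht.trans (mul_zero _).symm) (LinearMap.ext fun x => ?_)
    rw [← hy]
    change _ = lact (arrowSum K n) y x + ract (0 : DD K _) 0 x + α.1 (arrowSum K n) 0 x
    simp [ract]
  rw [h]
  exact Submodule.mul_mem_mul ((mem_rad_iff hn).2 arrowSum_mem)
    ((mem_rad_iff hn).2 (zero_mem _))

open Classical in
theorem coef_cls_zero_mul (i k : Cyc s) (m : ℕ) (a : TruncAlgebra K (Cyc s) n) :
    coef K n k m (cls K n i 0 * a) = if k = i then coef K n k m a else 0 := by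
  have h : coef K n k m ∘ₗ LinearMap.mulLeft K (cls K n i 0) =
      if k = i then coef K n k m else 0 := by
    refine cyc_linearMap_ext fun u l hl => ?_
    rw [LinearMap.comp_apply, LinearMap.mulLeft_apply, cls_mul, apply_ite (coef K n k m), map_zero,
      zero_add, coef_cls _ _ _ hl]
    by_cases hu : u = i
    · subst hu
      rw [if_pos (show u = u.shift 0 from rfl)]
      split_ifs with h1 h2
      · rw [coef_cls _ _ _ hl, if_pos h1]
      · exact absurd h1.1.symm h2
      · rw [coef_cls _ _ _ hl, if_neg h1]
      · rfl
    · rw [if_neg (show ¬ u = i.shift 0 from hu)]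
      split_ifs with h1
      · subst h1
        rw [coef_cls _ _ _ hl, if_neg fun h => hu h.1]
      · rfl
  have h2 := LinearMap.congr_fun h a
  split_ifs at h2 ⊢ <;> exact h2

open Classical in
theorem coef_mul_cls_zero (j k : Cyc s) (m : ℕ) (a : TruncAlgebra K (Cyc s) n) :
    coef K n k m (a * cls K n j 0) = if j = k.shift m then coef K n k m a else 0 := by
  have h : coef K n k m ∘ₗ LinearMap.mulRight K (cls K n j 0) =
      if j = k.shift m then coef K n k m else 0 := by
    refine cyc_linearMap_ext fun u l hl => ?_
    rw [LinearMap.comp_apply, LinearMap.mulRight_apply, cls_mul, apply_ite (coef K n k m), map_zero,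
      add_zero, coef_cls _ _ _ hl]
    by_cases hu : u = k ∧ l = m
    · obtain ⟨rfl, rfl⟩ := hu
      split_ifs with h1 h2
      · rw [coef_cls _ _ _ hl, if_pos ⟨rfl, rfl⟩]
      · exact absurd ⟨rfl, rfl⟩ h2
      · rfl
    · rw [if_neg hu, ite_self]
      split_ifs
      · rw [coef_cls _ _ _ hl, if_neg hu]
      · rfl
  have h2 := LinearMap.congr_fun h a
  split_ifs at h2 ⊢ <;> exact h2

theorem mem_filt_two {a : TruncAlgebra K (Cyc s) n} (h0 : a ∈ filt K n 1)
    (h1 : ∀ i, coef K n i 1 a = 0) : a ∈ filt K n 2 := by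
  refine (mem_filt a).2 fun i k hk => ?_
  rcases (by omega : k = 0 ∨ k = 1) with rfl | rfl
  · exact (mem_filt a).1 h0 i 0 zero_lt_one
  · exact h1 i

open Classical in
theorem IsVertexLift.coef_one_corner {e : Cyc s → HochschildExt α} (he : IsVertexLift e)
    (i j k : Cyc s) (t : HochschildExt α) :
    coef K n k 1 (e i * (t * e j)).fst =
      if k = i ∧ j = i.next then coef K n i 1 t.fst else 0 := by
  rw [HochschildExt.fst_mul, HochschildExt.fst_mul, he.lifts, he.lifts, vertexIdem_eq,
    vertexIdem_eq, coef_cls_zero_mul, coef_mul_cls_zero]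
  by_cases hk : k = i
  · subst hk
    rw [if_pos rfl]
    exact if_congr ⟨fun h => ⟨rfl, h⟩, fun h => h.2⟩ rfl rfl
  · rw [if_neg hk, if_neg fun h => hk h.1]

theorem IsVertexLift.fst_corner_mem {e : Cyc s → HochschildExt α} (he : IsVertexLift e)
    {i j : Cyc s} {t : HochschildExt α} (ht : t.fst ∈ filt K n 1)
    (h : j = i.next → coef K n i 1 t.fst = 0) : (e i * (t * e j)).fst ∈ filt K n 2 := by
  classical
  refine mem_filt_two (mul_mem_filt_left _ (mul_mem_filt_right ht _)) fun k => ?_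
  rw [he.coef_one_corner]
  split_ifs with h1
  · exact h h1.2
  · rfl

end Extension

/-! ### The square of the radical of an extension -/

section RadicalSquare

variable {K : Type*} [Field K] {s : ℕ} [NeZero s] {n : ℕ}
  {α : cocycles2 K (TruncAlgebra K (Cyc s) n)}
  {β : Cochain2 K (TruncAlgebra K (Cyc s) n)}
  {g : TruncAlgebra K (Cyc s) n →ₗ[K] DD K (TruncAlgebra K (Cyc s) n)}

/-- The cochain `α` differs from `β` by the coboundary of `g`. -/
def IsTwist (α : cocycles2 K (TruncAlgebra K (Cyc s) n))
    (β : Cochain2 K (TruncAlgebra K (Cyc s) n))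
    (g : TruncAlgebra K (Cyc s) n →ₗ[K] DD K (TruncAlgebra K (Cyc s) n)) : Prop :=
  ∀ a b, α.1 a b = β a b + (lact a (g b) - g (a * b) + ract (g a) b)

/-- The second component of the isomorphism `T_α(A) → T_β(A)`, `(a, x) ↦ (a, x + g a)`, if `α`
differs from `β` by the coboundary of `g`. -/
def untwist (α : cocycles2 K (TruncAlgebra K (Cyc s) n))
    (g : TruncAlgebra K (Cyc s) n →ₗ[K] DD K (TruncAlgebra K (Cyc s) n)) :
    HochschildExt α →ₗ[K] DD K (TruncAlgebra K (Cyc s) n) where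
  toFun t := t.snd + g t.fst
  map_add' t u := by
    rw [HochschildExt.snd_add, HochschildExt.fst_add, map_add, add_add_add_comm]
  map_smul' c t := by
    rw [HochschildExt.snd_smul, HochschildExt.fst_smul, map_smul, RingHom.id_apply, smul_add]

theorem untwist_apply (t : HochschildExt α) : untwist α g t = t.snd + g t.fst := rfl

theorem IsTwist.untwist_mul (h : IsTwist α β g) (t u : HochschildExt α) :
    untwist α g (t * u) =
      lact t.fst (untwist α g u) + ract (untwist α g t) u.fst + β t.fst u.fst := by
  refine LinearMap.ext fun x => ?_
  rw [untwist_apply, HochschildExt.snd_mul, h, HochschildExt.fst_mul]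
  simp only [untwist_apply, lact, ract, LinearMap.add_apply, LinearMap.sub_apply,
    LinearMap.comp_apply]
  ring

theorem untwist_of_fst_eq_zero {t : HochschildExt α} (ht : t.fst = 0) :
    untwist α g t = t.snd := by
  rw [untwist_apply, ht, map_zero, add_zero]

/-- The preimage of `(a, x)` under the isomorphism `T_α(A) → T_β(A)` given by `untwist`. -/
def twisted (α : cocycles2 K (TruncAlgebra K (Cyc s) n))
    (g : TruncAlgebra K (Cyc s) n →ₗ[K] DD K (TruncAlgebra K (Cyc s) n))
    (a : TruncAlgebra K (Cyc s) n) (x : DD K (TruncAlgebra K (Cyc s) n)) : HochschildExt α :=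
  HochschildExt.mk a (x - g a)

theorem twisted_fst (a : TruncAlgebra K (Cyc s) n) (x : DD K (TruncAlgebra K (Cyc s) n)) :
    (twisted α g a x).fst = a := rfl

theorem untwist_twisted (a : TruncAlgebra K (Cyc s) n) (x : DD K (TruncAlgebra K (Cyc s) n)) :
    untwist α g (twisted α g a x) = x :=
  sub_add_cancel x (g a)

theorem IsTwist.untwist_twisted_mul (h : IsTwist α β g) (a b : TruncAlgebra K (Cyc s) n) :
    untwist α g (twisted α g a 0 * twisted α g b 0) = β a b := by
  rw [h.untwist_mul, untwist_twisted, untwist_twisted, twisted_fst, twisted_fst]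
  simp [lact, ract]

theorem twisted_mul_mem (hn : 0 < n) {a b : TruncAlgebra K (Cyc s) n} (ha : a ∈ filt K n 1)
    (hb : b ∈ filt K n 1) :
    twisted α g a 0 * twisted α g b 0 ∈ rad K (HochschildExt α) * rad K (HochschildExt α) :=
  Submodule.mul_mem_mul ((mem_rad_iff hn).2 ha) ((mem_rad_iff hn).2 hb)

/-- Modulo the square of the radical, an element `(a, x)` with `a ∈ rad² A` can be moved into
`D(A)`, at the expense of a value of `β`. -/
theorem IsTwist.exists_sub_mem (h : IsTwist α β g) (hn : 0 < n) {t : HochschildExt α}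
    (ht : t.fst ∈ filt K n 2) :
    ∃ u : HochschildExt α, t - u ∈ rad K (HochschildExt α) * rad K (HochschildExt α) ∧
      u.fst = 0 ∧ ∃ b, untwist α g u = untwist α g t - β b (arrowSum K n) := by
  obtain ⟨b, hb, hba⟩ := exists_mul_arrowSum ht
  refine ⟨t - twisted α g b 0 * twisted α g (arrowSum K n) 0, ?_, ?_, b, ?_⟩
  · rw [sub_sub_cancel]
    exact twisted_mul_mem hn hb arrowSum_mem
  · exact sub_eq_zero.2 hba.symm
  · rw [map_sub, h.untwist_twisted_mul]

/-! ### Extensions that are invisible on the socle -/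

/-- If `β` vanishes on the paths of length `n - 1`, then a product of two elements of the radical
has no component that can be evaluated at these paths. -/
theorem IsTwist.untwist_eq_zero_of_mem (h : IsTwist α β g) (hn : 0 < n)
    (hβ : ∀ a b i, β a b (cls K n i (n - 1)) = 0) {t : HochschildExt α}
    (ht : t ∈ rad K (HochschildExt α) * rad K (HochschildExt α)) (i : Cyc s) :
    untwist α g t (cls K n i (n - 1)) = 0 := by
  have h1 : rad K (HochschildExt α) * rad K (HochschildExt α) ≤
      LinearMap.ker (LinearMap.applyₗ (cls K n i (n - 1)) ∘ₗ untwist α g) := by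
    refine Submodule.mul_le.2 fun a ha b hb => ?_
    rw [mem_rad_iff hn] at ha hb
    rw [LinearMap.mem_ker, LinearMap.comp_apply, LinearMap.applyₗ_apply_apply, h.untwist_mul,
      LinearMap.add_apply, LinearMap.add_apply, hβ, lact, ract, LinearMap.comp_apply,
      LinearMap.comp_apply, LinearMap.mulRight_apply, LinearMap.mulLeft_apply,
      eq_zero_of_mem_filt (m := n - 1 + 1) (by omega)
        (mul_mem_filt (cls_mem_filt i le_rfl) ha),
      eq_zero_of_mem_filt (m := 1 + (n - 1)) (by omega)
        (mul_mem_filt hb (cls_mem_filt i le_rfl)), map_zero, map_zero, add_zero, add_zero]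
  exact h1 ht

theorem IsTwist.mem_rad_sq (h : IsTwist α β g) (hn : 0 < n)
    (hβ : ∀ a b i, β a b (cls K n i (n - 1)) = 0) {t : HochschildExt α}
    (ht : t.fst ∈ filt K n 2) (ht' : ∀ i, untwist α g t (cls K n i (n - 1)) = 0) :
    t ∈ rad K (HochschildExt α) * rad K (HochschildExt α) := by
  obtain ⟨u, hu, hu0, b, hub⟩ := h.exists_sub_mem hn ht
  rw [← sub_add_cancel t u]
  refine add_mem hu (mem_rad_sq_of_fst_eq_zero hn hu0 fun i => ?_)
  rw [← untwist_of_fst_eq_zero (g := g) hu0, hub, LinearMap.sub_apply, ht', hβ, sub_zero]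

open Classical in
theorem IsTwist.untwist_corner (h : IsTwist α β g) (hn : 0 < n)
    (hβ : ∀ a b i, β a b (cls K n i (n - 1)) = 0) {e : Cyc s → HochschildExt α}
    (he : IsVertexLift e) (i j k : Cyc s) {t : HochschildExt α} (ht : t.fst ∈ filt K n 1) :
    untwist α g (e i * (t * e j)) (cls K n k (n - 1)) =
      if k = j ∧ i = k.shift (n - 1) then untwist α g t (cls K n j (n - 1)) else 0 := by
  have hl : ∀ {a}, a ∈ filt K (s := s) n 1 → a * cls K n k (n - 1) = 0 := fun ha =>
    eq_zero_of_mem_filt (m := 1 + (n - 1)) (by omega) (mul_mem_filt ha (cls_mem_filt k le_rfl))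
  have hr : ∀ {a}, a ∈ filt K (s := s) n 1 → cls K n k (n - 1) * a = 0 := fun ha =>
    eq_zero_of_mem_filt (m := n - 1 + 1) (by omega) (mul_mem_filt (cls_mem_filt k le_rfl) ha)
  have h1 : untwist α g (t * e j) (cls K n k (n - 1)) =
      if k = j then untwist α g t (cls K n j (n - 1)) else 0 := by
    rw [h.untwist_mul, LinearMap.add_apply, LinearMap.add_apply, hβ, lact, ract,
      LinearMap.comp_apply, LinearMap.comp_apply, LinearMap.mulRight_apply,
      LinearMap.mulLeft_apply, hr ht, map_zero, zero_add, add_zero, he.lifts, vertexIdem_eq,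
      cls_mul, zero_add, apply_ite (untwist α g t), map_zero]
    rfl
  rw [h.untwist_mul, LinearMap.add_apply, LinearMap.add_apply, hβ, lact, ract,
    LinearMap.comp_apply, LinearMap.comp_apply, LinearMap.mulRight_apply,
    LinearMap.mulLeft_apply, HochschildExt.fst_mul, hl (mul_mem_filt_right ht _), map_zero,
    add_zero, add_zero, he.lifts, vertexIdem_eq, cls_mul, apply_ite (untwist α g (t * e j)),
    map_zero, add_zero, h1, ← ite_and]
  exact if_congr and_comm rfl rfl

/-- The quiver of the trivial extension algebra: in addition to the arrows of the cyclic quiver,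
there is an arrow `i → j` for each path of length `n - 1` from `j` to `i`. -/
def ExtArrow (n : ℕ) (i j : Cyc s) : Type := (i ⟶ j) ⊕ {_x : Unit // i = j.shift (n - 1)}

instance (i j : Cyc s) : Finite (i ⟶ j) := inferInstanceAs (Finite {_x : Unit // j = i.next})

instance (n : ℕ) (i j : Cyc s) : Finite (ExtArrow n i j) :=
  inferInstanceAs (Finite ((i ⟶ j) ⊕ {_x : Unit // i = j.shift (n - 1)}))

/-- If `β` vanishes on the paths of length `n - 1`, then `T_α(A)` has the quiver of the trivial
extension algebra. -/
theorem IsTwist.hasOrdinaryQuiver_extArrow (h : IsTwist α β g) (hn : 1 < n)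
    (hβ : ∀ a b i, β a b (cls K n i (n - 1)) = 0) :
    HasOrdinaryQuiver α (ExtArrow (s := s) n) := by
  classical
  have hn0 : 0 < n := by omega
  refine hasOrdinaryQuiver_of hn0 fun e he i j => ?_
  let L : HochschildExt α →ₗ[K] (ExtArrow n i j → K) := LinearMap.pi (Sum.elim
    (fun _ => coef K n i 1 ∘ₗ fstLin α)
    (fun _ => LinearMap.applyₗ (cls K n j (n - 1)) ∘ₗ untwist α g))
  have hL1 : ∀ t x, L t (Sum.inl x) = coef K n i 1 t.fst := fun _ _ => rfl
  have hL2 : ∀ t x, L t (Sum.inr x) = untwist α g t (cls K n j (n - 1)) := fun _ _ => rfl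
  refine arrowNumber_eq_card (he.complete.idem i) (he.complete.idem j) L ?_ ?_ ?_ ?_
  · intro u
    refine ⟨twisted α g
      ((if h : j = i.next then u (Sum.inl ⟨(), h⟩) else 0) • cls K n i 1)
      ((if h : i = j.shift (n - 1) then u (Sum.inr ⟨(), h⟩) else 0) • coef K n j (n - 1)),
      (mem_rad_iff hn0).2 ?_, funext ?_⟩
    · exact Submodule.smul_mem _ _ (cls_mem_filt i le_rfl)
    · rintro (⟨_, hx⟩ | ⟨_, hx⟩)
      · rw [hL1, twisted_fst, map_smul, coef_cls _ _ _ hn, dif_pos hx, if_pos ⟨rfl, rfl⟩,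
          smul_eq_mul, mul_one]
      · rw [hL2, untwist_twisted, LinearMap.smul_apply, coef_cls _ _ _ (by omega), dif_pos hx,
          if_pos ⟨rfl, rfl⟩, smul_eq_mul, mul_one]
  · intro t ht
    refine funext ?_
    rintro (⟨_, hx⟩ | ⟨_, hx⟩)
    · rw [hL1, hL1, he.coef_one_corner, if_pos ⟨rfl, hx⟩]
    · rw [hL2, hL2, h.untwist_corner hn0 hβ he i j j ((mem_rad_iff hn0).1 ht), if_pos ⟨rfl, hx⟩]
  · intro t ht hLt
    rw [mem_rad_iff hn0] at ht
    refine h.mem_rad_sq hn0 hβ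
      (he.fst_corner_mem ht fun hx => congrFun hLt (Sum.inl ⟨(), hx⟩)) fun k => ?_
    rw [h.untwist_corner hn0 hβ he i j k ht]
    split_ifs with hk
    · exact congrFun hLt (Sum.inr ⟨(), hk.1 ▸ hk.2⟩)
    · rfl
  · intro t ht
    refine funext ?_
    rintro (⟨_, hx⟩ | ⟨_, hx⟩)
    · exact (mem_filt _).1 (fst_mem_of_mem_rad_sq hn0 ht) i 1 one_lt_two
    · exact h.untwist_eq_zero_of_mem hn0 hβ ht j

/-! ### Extensions that are nondegenerate on the socle -/

/-- If every functional on the span of the paths of length `n - 1` is a combination of values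
`β a b` with `a, b ∈ rad A` and `a b = 0`, then `D(A)` lies in the square of the radical, so that
`T_α(A)` has the quiver of `A`. -/
theorem IsTwist.hasOrdinaryQuiver_hom (h : IsTwist α β g) (hn : 1 < n)
    (hβ : ∀ i : Cyc s, ∃ a ∈ filt K n 1, ∃ b ∈ filt K n 1, a * b = 0 ∧
      β a b (cls K n i (n - 1)) ≠ 0 ∧ ∀ k ≠ i, β a b (cls K n k (n - 1)) = 0) :
    HasOrdinaryQuiver α (fun i j : Cyc s => i ⟶ j) := by
  classical
  have hn0 : 0 < n := by omega
  have hD : ∀ u : HochschildExt α, u.fst = 0 →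
      u ∈ rad K (HochschildExt α) * rad K (HochschildExt α) := by
    intro u hu
    choose a ha b hb hab hne hz using hβ
    let v : HochschildExt α := ∑ i, ((β (a i) (b i) (cls K n i (n - 1)))⁻¹ *
      u.snd (cls K n i (n - 1))) • (twisted α g (a i) 0 * twisted α g (b i) 0)
    have hv : v ∈ rad K (HochschildExt α) * rad K (HochschildExt α) :=
      Submodule.sum_mem _ fun i _ => Submodule.smul_mem _ _ (twisted_mul_mem hn0 (ha i) (hb i))
    have hv0 : v.fst = 0 := by
      refine (map_sum (fstLin α) _ _).trans (Finset.sum_eq_zero fun i _ => ?_)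
      rw [map_smul, show fstLin α (twisted α g (a i) 0 * twisted α g (b i) 0) = a i * b i from rfl,
        hab, smul_zero]
    have hvk : ∀ k, v.snd (cls K n k (n - 1)) = u.snd (cls K n k (n - 1)) := by
      intro k
      rw [← untwist_of_fst_eq_zero (g := g) hv0, map_sum, LinearMap.sum_apply,
        Finset.sum_eq_single k]
      · rw [map_smul, h.untwist_twisted_mul, LinearMap.smul_apply, smul_eq_mul, mul_right_comm,
          inv_mul_cancel₀ (hne k), one_mul]
      · intro i _ hi
        rw [map_smul, h.untwist_twisted_mul, LinearMap.smul_apply, hz i k hi.symm, smul_zero]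
      · simp
    rw [← sub_add_cancel u v]
    refine add_mem (mem_rad_sq_of_fst_eq_zero hn0 ?_ fun k => ?_) hv
    · exact (map_sub (fstLin α) u v).trans (by
        rw [show fstLin α u = 0 from hu, show fstLin α v = 0 from hv0, sub_zero])
    · rw [show (u - v).snd = u.snd - v.snd from rfl, LinearMap.sub_apply, hvk, sub_self]
  have hsq : ∀ t : HochschildExt α, t.fst ∈ filt K n 2 →
      t ∈ rad K (HochschildExt α) * rad K (HochschildExt α) := by
    intro t ht
    obtain ⟨u, hu, hu0, -⟩ := h.exists_sub_mem hn0 ht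
    rw [← sub_add_cancel t u]
    exact add_mem hu (hD u hu0)
  refine hasOrdinaryQuiver_of hn0 fun e he i j => ?_
  let L : HochschildExt α →ₗ[K] ((i ⟶ j) → K) := LinearMap.pi fun _ => coef K n i 1 ∘ₗ fstLin α
  have hL : ∀ t x, L t x = coef K n i 1 t.fst := fun _ _ => rfl
  refine arrowNumber_eq_card (he.complete.idem i) (he.complete.idem j) L ?_ ?_ ?_ ?_
  · intro u
    refine ⟨twisted α g ((if h : j = i.next then u ⟨(), h⟩ else 0) • cls K n i 1) 0,
      (mem_rad_iff hn0).2 (Submodule.smul_mem _ _ (cls_mem_filt i le_rfl)), funext ?_⟩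
    rintro ⟨_, hx⟩
    rw [hL, twisted_fst, map_smul, coef_cls _ _ _ hn, dif_pos hx, if_pos ⟨rfl, rfl⟩,
      smul_eq_mul, mul_one]
  · intro t ht
    refine funext ?_
    rintro ⟨_, hx⟩
    rw [hL, hL, he.coef_one_corner, if_pos ⟨rfl, hx⟩]
  · intro t ht hLt
    exact hsq _ (he.fst_corner_mem ((mem_rad_iff hn0).1 ht) fun hx => congrFun hLt ⟨(), hx⟩)
  · intro t ht
    exact funext fun x => (mem_filt _).1 (fst_mem_of_mem_rad_sq hn0 ht) i 1 one_lt_two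

end RadicalSquare

/-! ### The comparison map on the standard basis -/

section Theta

variable {K : Type*} [Field K] {s : ℕ} [NeZero s] {n q : ℕ}

theorem pathClass_mem_filt {p : QPath (Cyc s)} {m : ℕ} (h : m ≤ p.length) :
    pathClass K n p ∈ filt K n m := by
  rw [Cyc.eq_qpath p]
  exact cls_mem_filt _ h

theorem tens_pathClass {m : ℕ} (x : ChainIndex (Cyc s) n m q) :
    tens K n m q x.1.2 (pathClass K n x.1.1.1) = Finsupp.single x 1 :=
  (truncLift_pathClass _ _).trans ((dif_pos x.1.1.2).trans (dif_pos x.2))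

/-- The tensor `p ⊗ y` has a component in degree `q` only if `p y` is a cycle of length `q`. -/
theorem tens_cls_eq_zero {m : ℕ} {y : QPath (Cyc s)} {u : Cyc s} {r : ℕ}
    (h : ¬ (r + m = q ∧ u.shift r = y.src)) : tens K n m q y (cls K n u r) = 0 := by
  by_cases hr : r < n
  · refine (truncLift_cls _ u hr).trans (dif_neg fun h1 => h ⟨?_, h1.2.2.1⟩)
    rw [← h1.2.1, Cyc.qpath_length]
  · rw [cls_eq_zero u (not_lt.1 hr), map_zero]

open Classical in
theorem theta_cls (f : Module.Dual K (Chains K (Cyc s) n n q)) (i j : Cyc s) {k l : ℕ}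
    (hk : k < n) (hl : l < n) (x : TruncAlgebra K (Cyc s) n) :
    theta f (cls K n i k) (cls K n j l) x =
      if j = i.shift k ∧ n ≤ k + l then
        f (tens K n n q (Cyc.qpath i n) (cls K n (i.shift n) (k + l - n) * x))
      else 0 := by
  have h : theta f (cls K n i k) (cls K n j l) = thetaPath f (Cyc.qpath i k) (Cyc.qpath j l) :=
    
    (LinearMap.congr_fun (truncLift_cls _ i hk) (cls K n j l)).trans (truncLift_cls _ j hl)
  rw [h, thetaPath, Cyc.qpath_comp?]
  by_cases hj : j = i.shift k
  · rw [if_pos hj, Option.elim_some, Cyc.qpath_length]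
    by_cases hkl : n ≤ k + l
    · rw [if_pos hkl, if_pos ⟨hj, hkl⟩, Cyc.qpath_take i hkl, Cyc.qpath_drop i hkl]
      rfl
    · rw [if_neg hkl, if_neg fun h => hkl h.2]
      rfl
  · rw [if_neg hj, if_neg fun h => hj h.1]
    rfl

theorem theta_zero :
    theta (0 : Module.Dual K (Chains K (Cyc s) n n q)) = 0 := by
  classical
  refine cyc_linearMap_ext fun i k hk => cyc_linearMap_ext fun j l hl => LinearMap.ext fun x => ?_
  rw [theta_cls _ i j hk hl, LinearMap.zero_apply, ite_self]
  rfl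

/-- A cochain `Θ(f)` of degree `q ≤ 2n - 2` vanishes on the paths of length `n - 1`: the paths
`a`, `b`, `x` with `|a b| ≥ n` and `|x| = n - 1` have total length at least `2n - 1`. -/
theorem theta_apply_socle (hn : 0 < n) (hq : q ≤ 2 * n - 2)
    (f : Module.Dual K (Chains K (Cyc s) n n q)) (a b : TruncAlgebra K (Cyc s) n) (u : Cyc s) :
    theta f a b (cls K n u (n - 1)) = 0 := by
  classical
  have h : (theta f).compr₂ (LinearMap.applyₗ (cls K n u (n - 1))) = 0 := by
    refine cyc_linearMap_ext fun i k hk => cyc_linearMap_ext fun j l hl => ?_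
    rw [LinearMap.compr₂_apply, LinearMap.applyₗ_apply_apply, theta_cls f i j hk hl, cls_mul]
    split_ifs with h1 h2
    · rw [tens_cls_eq_zero (by omega), map_zero]
      rfl
    · rw [map_zero, map_zero]
      rfl
    · rfl
  exact LinearMap.congr_fun₂ h a b

/-- The value of `f` at `p ⊗ w`, where `w` is the path of length `n` that starts at `i` and `p` is
the path of length `n - 1` that continues `w`. -/
def socleValue (f : Module.Dual K (Chains K (Cyc s) n n q)) (i : Cyc s) : K :=
  f (tens K n n q (Cyc.qpath i n) (cls K n (i.shift n) (n - 1)))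

open Classical in
theorem theta_arrow_apply (hn : 1 < n) (f : Module.Dual K (Chains K (Cyc s) n n q))
    (i u : Cyc s) :
    theta f (cls K n i (n - 1)) (cls K n (i.shift (n - 1)) 1) (cls K n u (n - 1)) =
      if u = i.shift n then socleValue f i else 0 := by
  rw [theta_cls f _ _ (by omega) hn, if_pos ⟨rfl, by omega⟩, cls_mul,
    show n - 1 + 1 - n = 0 by omega, zero_add, apply_ite (tens K n n q (Cyc.qpath i n)),
    apply_ite f, map_zero, map_zero]
  rfl

theorem cycle_of_socleValue_ne_zero (hn : 0 < n) {f : Module.Dual K (Chains K (Cyc s) n n q)}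
    {i : Cyc s} (h : socleValue f i ≠ 0) (j : Cyc s) : j.shift (2 * n - 1) = j := by
  refine Cyc.shift_eq_self (i := i) ?_ j
  by_contra hi
  refine h ?_
  rw [socleValue, tens_cls_eq_zero, map_zero]
  rintro ⟨-, h2⟩
  rw [← Cyc.shift_add, show n + (n - 1) = 2 * n - 1 by omega] at h2
  exact hi h2

/-- In the top degree a functional is determined by its values `socleValue`. -/
theorem eq_zero_of_socleValue (hq : q = 2 * n - 1) (hn : 0 < n)
    {f : Module.Dual K (Chains K (Cyc s) n n q)} (h : ∀ i, socleValue f i = 0) : f = 0 := by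
  refine Finsupp.lhom_ext' fun x => LinearMap.ext_ring ?_
  change f (Finsupp.single x 1) = 0
  obtain ⟨hx1, hx2, hx3, hx4⟩ := x.2
  rw [← tens_pathClass x, Cyc.eq_qpath_of (p := x.1.2) rfl hx1,
    Cyc.eq_qpath_of (p := x.1.1.1) (i := x.1.2.src.shift n) (k := n - 1)
      (by rw [← hx4, Cyc.tgt_eq, hx1]) (by omega)]
  exact h _

/-- In the top degree all chains are cycles, since `d₂` produces paths of length at least `n`. -/
theorem d2_eq_zero (hq : q = 2 * n - 1) (hn : 1 < n) : d2 K (Cyc s) n q = 0 := by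
  refine Finsupp.lhom_ext' fun x => LinearMap.ext_ring ?_
  change d2 K (Cyc s) n q (Finsupp.single x 1) = 0
  obtain ⟨hx1, hx2, -, -⟩ := x.2
  rw [d2, Finsupp.linearCombination_single, one_smul]
  refine Finset.sum_eq_zero fun j hj => ?_
  rw [Finset.mem_range] at hj
  have h1 : (x.1.2.drop (j + 1)).length = n - (j + 1) :=
    (QPath.splitAux_length _ _).2.trans (congrArg (· - (j + 1)) hx1)
  have h2 : (x.1.2.take j).length = min j n :=
    (QPath.splitAux_length _ _).1.trans (congrArg (min j) hx1)
  rw [eq_zero_of_mem_filt (m := n - (j + 1) + (n - 1) + j) (by omega)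
    (mul_mem_filt (mul_mem_filt (pathClass_mem_filt (by omega)) (pathClass_mem_filt (by omega)))
      (pathClass_mem_filt (by omega))), map_zero]

/-- In the top degree a functional that vanishes on the image of `d₃` takes the same value at all
basis elements. -/
theorem socleValue_next (hq : q = 2 * n - 1) (hn : 1 < n)
    {f : Module.Dual K (Chains K (Cyc s) n n q)} (hf : ∀ z, f (d3 K (Cyc s) n q z) = 0)
    (hc : ∀ j : Cyc s, j.shift (2 * n - 1) = j) (i : Cyc s) :
    socleValue f i.next = socleValue f i := by
  have hi : (i.shift (n + 1)).shift (n - 2) = i := by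
    rw [← Cyc.shift_add, show n + 1 + (n - 2) = 2 * n - 1 by omega, hc]
  let x : ChainIndex (Cyc s) n (n + 1) q :=
    ⟨(⟨Cyc.qpath (i.shift (n + 1)) (n - 2), by rw [Cyc.qpath_length]; omega⟩,
      Cyc.qpath i (n + 1)), Cyc.qpath_length _ _, by rw [Cyc.qpath_length]; omega, hi, rfl⟩
  have h := hf (Finsupp.single x 1)
  rw [d3, Finsupp.linearCombination_single, one_smul] at h
  dsimp only [x] at h
  rw [Cyc.qpath_drop i (by omega), Cyc.qpath_drop i (by omega), Cyc.qpath_take i (by omega),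
    Cyc.qpath_take i (by omega)] at h
  change f (tens K n n q (Cyc.qpath i.next n) (cls K n (i.shift (n + 1)) (n - 2) * cls K n i 1) -
    tens K n n q (Cyc.qpath i n)
      (cls K n (i.shift n) (n + 1 - n) * cls K n (i.shift (n + 1)) (n - 2))) = 0 at h
  rw [cls_mul, if_pos hi.symm, cls_mul, show n + 1 - n = 1 by omega,
    if_pos (Cyc.shift_add i n 1), show n - 2 + 1 = n - 1 by omega,
    show 1 + (n - 2) = n - 1 by omega, add_comm n 1, Cyc.shift_add, map_sub, sub_eq_zero] at h
  exact h

theorem socleValue_eq (hq : q = 2 * n - 1) (hn : 1 < n)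
    {f : Module.Dual K (Chains K (Cyc s) n n q)} (hf : ∀ z, f (d3 K (Cyc s) n q z) = 0)
    (hc : ∀ j : Cyc s, j.shift (2 * n - 1) = j) (i j : Cyc s) :
    socleValue f j = socleValue f i := by
  obtain ⟨k, rfl⟩ := Cyc.exists_shift_eq i j
  induction k with
  | zero => rfl
  | succ k ih => exact (socleValue_next hq hn hf hc _).trans ih

end Theta

theorem exists_isTwist {K : Type*} [Field K] {s : ℕ} [NeZero s] {n : ℕ}
    {α β : cocycles2 K (TruncAlgebra K (Cyc s) n)} (h : cohClass α = cohClass β) :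
    ∃ g, IsTwist α β.1 g := by
  obtain ⟨g, hg⟩ := (Submodule.Quotient.eq _).1 h
  refine ⟨g, fun a b => ?_⟩
  rw [← hg a b]
  exact (add_sub_cancel (β.1 a b) (α.1 a b)).symm

end HochExt

end

theorem theorem4p3 (K : Type*) [Field K] (s n q : ℕ) [NeZero s] (hn : 2 ≤ n)
    (hnq : n ≤ q) (hq : q ≤ 2 * n - 1)
    (α : HochExt.cocycles2 K (HochExt.TruncAlgebra K (HochExt.Cyc s) n))
    (hα : HochExt.cohClass α ∈ HochExt.thetaImage K (HochExt.Cyc s) n q) :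
    (q ≤ 2 * n - 2 → ∃ Q : HochExt.Cyc s → HochExt.Cyc s → Type,
      HochExt.HasOrdinaryQuiver α Q ∧
      HochExt.HasOrdinaryQuiver
        (0 : HochExt.cocycles2 K (HochExt.TruncAlgebra K (HochExt.Cyc s) n)) Q) ∧
    (q = 2 * n - 1 → HochExt.cohClass α ≠ 0 →
      HochExt.HasOrdinaryQuiver α (fun i j : HochExt.Cyc s => i ⟶ j)) := by
  classical
  obtain ⟨φ, f, β, hφ, hβ, hαβ⟩ := hα
  obtain ⟨g, hg⟩ := HochExt.exists_isTwist hαβ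
  rw [hβ] at hg
  constructor
  · intro hq2
    refine ⟨HochExt.ExtArrow n, hg.hasOrdinaryQuiver_extArrow hn
      (HochExt.theta_apply_socle (by omega) hq2 f), ?_⟩
    have h0 : HochExt.IsTwist (0 : HochExt.cocycles2 K (HochExt.TruncAlgebra K (HochExt.Cyc s) n))
        0 0 := fun a b => by
      refine LinearMap.ext fun x => ?_
      simp [HochExt.lact, HochExt.ract]
    exact h0.hasOrdinaryQuiver_extArrow hn fun _ _ _ => rfl
  · intro hq2 hne
    have hf : ∀ z, f (HochExt.d3 K (HochExt.Cyc s) n q z) = 0 := by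
      intro z
      rw [hφ ⟨HochExt.d3 K (HochExt.Cyc s) n q z, by
        rw [HochExt.d2_eq_zero hq2 hn, LinearMap.ker_zero]; trivial⟩]
      refine (congrArg φ ?_).trans (map_zero φ)
      exact (Submodule.Quotient.mk_eq_zero _).2 ⟨z, rfl⟩
    -- If `f` vanished at all basis elements, then `Θ(f) = 0` and the class of `α` would be zero.
    obtain ⟨i₀, hi₀⟩ : ∃ i, HochExt.socleValue f i ≠ 0 := by
      by_contra! h
      refine hne ?_
      have hβ0 : β = 0 := Subtype.ext (by
        rw [hβ, HochExt.eq_zero_of_socleValue hq2 (by omega) h, HochExt.theta_zero]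
        rfl)
      rw [hαβ, hβ0]
      rfl
    have hc := HochExt.cycle_of_socleValue_ne_zero (by omega) hi₀
    refine hg.hasOrdinaryQuiver_hom hn fun u => ?_
    -- `i` is the vertex from which a path of length `n` leads to `u`.
    obtain ⟨i, hi⟩ : ∃ i : HochExt.Cyc s, i.shift n = u := by
      refine ⟨u.shift (n - 1), ?_⟩
      rw [← HochExt.Cyc.shift_add, show n - 1 + n = 2 * n - 1 by omega, hc]
    refine ⟨HochExt.cls K n i (n - 1), HochExt.cls_mem_filt _ (by omega),
      HochExt.cls K n (i.shift (n - 1)) 1, HochExt.cls_mem_filt _ le_rfl, ?_, ?_, ?_⟩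
    · rw [HochExt.cls_mul, if_pos rfl, HochExt.cls_eq_zero _ (by omega)]
    · rw [HochExt.theta_arrow_apply hn, if_pos hi.symm, HochExt.socleValue_eq hq2 hn hf hc i₀ i]
      exact hi₀
    · intro k hk
      rw [HochExt.theta_arrow_apply hn, if_neg fun h => hk (h.trans hi)]
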